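/- **Setting.** Let $d\ge 1$ and let $\mathcal X\subset\{0,1\}^d$ be a non-empty set of decisions. In round $t=1,2,\dots$ a learner selects $x(t)\in\mathcal X$, a vector $Z(t)$ with independent coordinates $Z_i(t)\sim\mathrm{Bernoulli}(\theta_i)$ is drawn independently of the past, and the learner observes $x(t)\odot Z(t)$; the parameter $\theta\in[0,1]^d$ is unknown. The reward function $f:\mathcal X\times[0,1]^d\to\mathbb R$ is known, $f(x,\theta)$ is the expected reward of $x$ under $\theta$, and the regret is $$R(T,\theta,f)=T\max_{x\in\mathcal X}f(x,\theta)-\sum_{t=1}^T\mathbb E f(x(t),\theta).$$ Let $\mathcal F=\mathcal F(\mathcal X)$ be the class of $1$-Lipschitz reward functions, i.e. those with $|f(x,u)-f(x,v)|\le\sum_{i:x_i=1}|u_i-v_i|$ for all $x\in\mathcal X$, $u,v\in[0,1]^d$. Let $\mathcal F_0\subset\mathcal F$ be the functions in $\mathcal F$ for which moreover each $f(x,\cdot)$ is coordinatewise nondecreasing and $\mathbb E f(x,Z)=f(x,\theta)$ for all $x\in\mathcal X$ and all $\theta$, where $Z$ has independent coordinates $Z_i\sim\mathrm{Bernoulli}(\theta_i)$.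 The minimax regret of an algorithm over a class $\mathcal G$ is $\sup_{f\in\mathcal G,\theta\in[0,1]^d}R(T,\theta,f)$. For fixed $\mathcal X$ and $\mathcal G$, an algorithm is minimax optimal if there is a constant $K$ such that, for all large $T$, its minimax regret is at most $K$ times the infimum of the minimax regrets of all algorithms. Before round $t$ let $N_i$, $A_i$, $B_i$ be the numbers of observations, successes and failures of item $i$. *TS* draws $V$ with independent $V_i\sim\mathrm{Beta}(A_i+1,B_i+1)$ and selects $x(t)\in\arg\max_{x\in\mathcal X}f(x,V)$. *CUCB* forms the intervals $[L_i,U_i]=[0,1]\cap[\hat\theta_i-\rho_i,\hat\theta_i+\rho_i]$ with $\hat\theta_i=A_i/N_i$ and $\rho_i=\sqrt{3\ln t/(2N_i)}$ (and $[L_i,U_i]=[0,1]$ if $N_i=0$) and selects $x(t)\in\arg\max_{x\in\mathcal X}\sup_{u\in\prod_i[L_i,U_i]}f(x,u)$; if $f(x,\cdot)$ is nondecreasing, that supremum is $f(x,U)$. Ties are broken arbitrarily in both algorithms. **Statement.** There are universal constants $C_1,C_1'>0$ such that the following hold for every class $\mathcal G$ with $\mathcal F_0\subseteq\mathcal G\subseteq\mathcal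 F$, in particular for $\mathcal G=\mathcal F$. 1. For every $d\ge1$, with $\mathcal X=\{(1,\dots,1),(0,\dots,0)\}\subset\{0,1\}^d$, the minimax regret of TS satisfies, for all $T\ge1$, $$\sup_{f\in\mathcal G,\ \theta\in[0,1]^d}R(T,\theta,f)\ \ge\ C_1\,T^{1-1/d}.$$ 2. For every $m\ge1$, with $\mathcal X=\{e_1+\dots+e_m,\ e_{m+1}\}\subset\{0,1\}^{m+1}$, the minimax regret of TS is at least $C_1T^{1-1/m}$ for all $T\ge1$. 3. For every $d\ge1$, every non-empty $\mathcal X\subset\{0,1\}^d$ and all $T\ge2$, the minimax regret of CUCB satisfies $$\sup_{f\in\mathcal G,\ \theta\in[0,1]^d}R(T,\theta,f)\ \le\ C_1'\,d\,\sqrt{T\ln T}$$ (for this part $\mathcal G\subseteq\mathcal F$ is enough). 4. Hence TS is not minimax optimal over $\mathcal G$ in case 1 with $d\ge3$, and in case 2 with $m\ge3$. -/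

import Mathlib

open MeasureTheory ProbabilityTheory Filter

/-! Combinatorial semi-bandits with Bernoulli items. -/

namespace SemiBandit

/-- Vectors of `{0,1}^d`; these serve as decisions, as item outcomes `Z(t)` and as
observations `x(t) ⊙ Z(t)`. -/
abbrev BVec (d : ℕ) : Type := Fin d → Bool

/-- The real vector with entries `0` and `1` of a vector of `{0,1}^d`. -/
def BVec.toReal {d : ℕ} (z : BVec d) : Fin d → ℝ := fun i => if z i then 1 else 0

/-- Elementwise product `x ⊙ z`: the semi-bandit observation. -/
def BVec.mask {d : ℕ} (x z : BVec d) : BVec d := fun i => x i && z i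

/-- Parameters `θ ∈ [0,1]^d`. -/
abbrev Param (d : ℕ) : Type := Fin d → unitInterval

/-- A parameter as a vector of `ℝ^d`. -/
def Param.toReal {d : ℕ} (θ : Param d) : Fin d → ℝ := fun i => (θ i : ℝ)

/-- The law of `Z(t)`: independent coordinates, `Z_i(t)` Bernoulli of parameter `θ_i`. -/
noncomputable def outcomeLaw {d : ℕ} (θ : Param d) : PMF (BVec d) :=
  (Measure.pi fun i => bernoulliMeasure true false (θ i)).toPMF

/-- Reward functions `f(x, θ)`; only the values at `x ∈ 𝒳` and `θ ∈ [0,1]^d` matter. -/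
abbrev Reward (d : ℕ) : Type := BVec d → (Fin d → ℝ) → ℝ

/-- The pairs `(x(s), x(s) ⊙ Z(s))` of the past rounds, most recent first. -/
abbrev History (d : ℕ) : Type := List (BVec d × BVec d)

/-- A (randomized) policy: the law of the next decision given the past decisions and
observations. -/
abbrev Policy (d : ℕ) : Type := History d → PMF (BVec d)

/-- An algorithm: a policy for every reward function (the reward function is known to the
learner). -/
abbrev Algorithm (d : ℕ) : Type := Reward d → Policy d

/-- The law of the history after `t` rounds when policy `π` faces parameter `θ`. -/
noncomputable def historyLaw {d : ℕ} (π : Policy d) (θ : Param d) : ℕ → PMF (History d)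
  | 0 => PMF.pure []
  | t + 1 => (historyLaw π θ t).bind fun h =>
      (π h).bind fun x => (outcomeLaw θ).bind fun z => PMF.pure ((x, x.mask z) :: h)

/-- The law of the decision taken after `t` past rounds, that is, of `x(t + 1)`. -/
noncomputable def decisionLaw {d : ℕ} (π : Policy d) (θ : Param d) (t : ℕ) : PMF (BVec d) :=
  (historyLaw π θ t).bind π

/-- The regret over `T` rounds of policy `π` at parameter `θ`, where `f x θ` is the expected
reward of decision `x`:  `T max_{x ∈ 𝒳} f(x, θ) - ∑_{t ≤ T} E f(x(t), θ)`. -/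
noncomputable def regret {d : ℕ} (𝒳 : Finset (BVec d)) (f : Reward d) (π : Policy d)
    (θ : Param d) (T : ℕ) : ℝ :=
  T * (⨆ x : {x // x ∈ 𝒳}, f x.1 θ.toReal)
    - ∑ t ∈ Finset.range T, ∑ x, (decisionLaw π θ t x).toReal * f x θ.toReal

/-- The expected reward `E f(x, Z)` for `Z` drawn from the law of outcomes. -/
noncomputable def outcomeReward {d : ℕ} (f : Reward d) (θ : Param d) (x : BVec d) : ℝ :=
  ∑ z, (outcomeLaw θ z).toReal * f x z.toReal

/-- `f(x, θ)` is the expectation of the reward `f(x, Z)`. -/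
def IsMeanReward {d : ℕ} (𝒳 : Finset (BVec d)) (f : Reward d) : Prop :=
  ∀ x ∈ 𝒳, ∀ θ : Param d, outcomeReward f θ x = f x θ.toReal

/-- For every decision `x ∈ 𝒳` the map `θ ↦ f(x, θ)` on `[0,1]^d` is nondecreasing in each
coordinate. -/
def IsMonotoneReward {d : ℕ} (𝒳 : Finset (BVec d)) (f : Reward d) : Prop :=
  ∀ x ∈ 𝒳, MonotoneOn (f x) (Set.Icc 0 1)

/-- The class of `1`-Lipschitz reward functions: for every decision `x ∈ 𝒳`, the reward is a
`1`-Lipschitz function, for the `ℓ¹` norm, of the parameters in `[0,1]^d` of the selected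
items. -/
def lipschitzClass {d : ℕ} (𝒳 : Finset (BVec d)) : Set (Reward d) :=
  {f | ∀ x ∈ 𝒳, ∀ u ∈ Set.Icc (0 : Fin d → ℝ) 1, ∀ v ∈ Set.Icc (0 : Fin d → ℝ) 1,
    |f x u - f x v| ≤ ∑ i with x i = true, |u i - v i|}

/-- The `1`-Lipschitz reward functions that are moreover nondecreasing and satisfy
`E f(x, Z) = f(x, θ)`. -/
def regularClass {d : ℕ} (𝒳 : Finset (BVec d)) : Set (Reward d) :=
  {f | f ∈ lipschitzClass 𝒳 ∧ IsMonotoneReward 𝒳 f ∧ IsMeanReward 𝒳 f}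

/-- The minimax regret of an algorithm on `𝒳` over the class `𝓕` of reward functions: the
worst case over `f ∈ 𝓕` and `θ ∈ [0,1]^d` of the regret over `T` rounds. -/
noncomputable def minimaxRegret {d : ℕ} (𝒳 : Finset (BVec d)) (𝓕 : Set (Reward d))
    (alg : Algorithm d) (T : ℕ) : EReal :=
  ⨆ f ∈ 𝓕, ⨆ θ : Param d, (regret 𝒳 f (alg f) θ T : EReal)

/-- The algorithm only selects decisions of `𝒳`. -/
def IsAdmissible {d : ℕ} (𝒳 : Finset (BVec d)) (𝓕 : Set (Reward d)) (alg : Algorithm d) :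
    Prop :=
  ∀ f ∈ 𝓕, ∀ h, ∀ x ∈ (alg f h).support, x ∈ 𝒳

/-- The smallest minimax regret of any algorithm for the horizon `T`. -/
noncomputable def optimalRegret {d : ℕ} (𝒳 : Finset (BVec d)) (𝓕 : Set (Reward d)) (T : ℕ) :
    EReal :=
  ⨅ (alg : Algorithm d) (_ : IsAdmissible 𝒳 𝓕 alg), minimaxRegret 𝒳 𝓕 alg T

/-- Minimax optimality, in the usual sense of the order of growth in `T`: up to a constant
factor the minimax regret is the smallest possible one for all large horizons. -/
def IsMinimaxOptimal {d : ℕ} (𝒳 : Finset (BVec d)) (𝓕 : Set (Reward d)) (alg : Algorithm d) :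
    Prop :=
  ∃ K : ℝ, ∀ᶠ T : ℕ in atTop,
    minimaxRegret 𝒳 𝓕 alg T ≤ (K : EReal) * optimalRegret 𝒳 𝓕 T

/-- `N_i`: the number of past rounds in which item `i` was selected. -/
def pulls {d : ℕ} (h : History d) (i : Fin d) : ℕ :=
  h.countP fun p => p.1 i

/-- `A_i`: the number of successes observed on item `i`. -/
def successes {d : ℕ} (h : History d) (i : Fin d) : ℕ :=
  h.countP fun p => p.1 i && p.2 i

/-- `B_i`: the number of failures observed on item `i`. -/
def failures {d : ℕ} (h : History d) (i : Fin d) : ℕ :=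
  h.countP fun p => p.1 i && !p.2 i

/-- The posterior of `θ` for the uniform prior: the product of the laws
`Beta(A_i + 1, B_i + 1)`. -/
noncomputable def posterior {d : ℕ} (h : History d) : Measure (Fin d → ℝ) :=
  Measure.pi fun i => betaMeasure (successes h i + 1) (failures h i + 1)

/-- The decisions of `𝒳` that maximize `r`. -/
def maximizers {d : ℕ} (𝒳 : Finset (BVec d)) (r : BVec d → ℝ) : Set (BVec d) :=
  {x | x ∈ 𝒳 ∧ ∀ x' ∈ 𝒳, r x' ≤ r x}

/-- Thompson Sampling with uniform prior: the decision given the past is the second component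
of a pair `(V, x)` where `V` follows the posterior and `x ∈ argmax_{x ∈ 𝒳} f(x, V)` almost
surely. Ties are broken in an arbitrary, possibly randomized, way. -/
def IsThompsonSampling {d : ℕ} (𝒳 : Finset (BVec d)) (𝓕 : Set (Reward d))
    (alg : Algorithm d) : Prop :=
  ∀ f ∈ 𝓕, ∀ h : History d, ∃ ρ : Measure ((Fin d → ℝ) × BVec d),
    ρ.fst = posterior h ∧ ρ.snd = (alg f h).toMeasure ∧
      ∀ᵐ p ∂ρ, p.2 ∈ maximizers 𝒳 fun x => f x p.1

/-- The empirical mean of item `i`. -/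
noncomputable def empMean {d : ℕ} (h : History d) (i : Fin d) : ℝ :=
  successes h i / pulls h i

/-- The confidence radius `√(3 ln t / (2 N_i))` of item `i` in round `t`, where `t - 1` is the
length of the history. -/
noncomputable def radius {d : ℕ} (h : History d) (i : Fin d) : ℝ :=
  √(3 * Real.log (h.length + 1) / (2 * pulls h i))

/-- Upper confidence bounds, clipped to `[0,1]`; the bound is `1` for an unobserved item. -/
noncomputable def ucb {d : ℕ} (h : History d) : Fin d → ℝ := fun i =>
  if pulls h i = 0 then 1 else min 1 (empMean h i + radius h i)

/-- Lower confidence bounds, clipped to `[0,1]`; the bound is `0` for an unobserved item. -/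
noncomputable def lcb {d : ℕ} (h : History d) : Fin d → ℝ := fun i =>
  if pulls h i = 0 then 0 else max 0 (empMean h i - radius h i)

/-- The optimistic index of decision `x`: the largest reward of `x` over all parameters that
lie within the confidence bounds. If the reward is nondecreasing in the parameters, this is the
familiar `f(x, U)` with `U` the vector of upper confidence bounds, see `index_eq_of_monotone`. -/
noncomputable def index {d : ℕ} (f : Reward d) (h : History d) (x : BVec d) : ℝ :=
  sSup (f x '' Set.Icc (lcb h) (ucb h))

/-- CUCB: each round select a decision of `𝒳` with the largest optimistic index, with
arbitrary, possibly randomized, tie-breaking. -/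
def IsCUCB {d : ℕ} (𝒳 : Finset (BVec d)) (𝓕 : Set (Reward d)) (alg : Algorithm d) : Prop :=
  ∀ f ∈ 𝓕, ∀ h, ∀ x ∈ (alg f h).support, x ∈ maximizers 𝒳 (index f h)

/-- The decision set `{(1,…,1), (0,…,0)}` of `{0,1}^d`: take all items or none. -/
def allOrNothing (d : ℕ) : Finset (BVec d) := {fun _ => true, fun _ => false}

/-- The decision set `{e_1 + … + e_m, e_{m+1}}` of `{0,1}^(m+1)`. -/
def blockOrLast (m : ℕ) : Finset (BVec (m + 1)) :=
  {fun i => decide (i ≠ Fin.last m), fun i => decide (i = Fin.last m)}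

/-! Sanity facts. -/

theorem successes_le_pulls {d : ℕ} (h : History d) (i : Fin d) :
    successes h i ≤ pulls h i :=
  List.countP_mono_left fun p _ hp => by simp_all

theorem empMean_nonneg {d : ℕ} (h : History d) (i : Fin d) : 0 ≤ empMean h i := by
  unfold empMean; positivity

theorem empMean_le_one {d : ℕ} (h : History d) (i : Fin d) : empMean h i ≤ 1 :=
  div_le_one_of_le₀ (by exact_mod_cast successes_le_pulls h i) (by positivity)

theorem lcb_le_ucb {d : ℕ} (h : History d) : lcb h ≤ ucb h := by
  intro i
  have h0 := empMean_nonneg h i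
  have h1 := empMean_le_one h i
  have h2 : 0 ≤ radius h i := Real.sqrt_nonneg _
  unfold lcb ucb
  split_ifs
  · exact zero_le_one
  · simp only [le_min_iff, max_le_iff]
    refine ⟨⟨zero_le_one, ?_⟩, ?_, ?_⟩ <;> linarith

theorem Icc_lcb_ucb_subset {d : ℕ} (h : History d) :
    Set.Icc (lcb h) (ucb h) ⊆ Set.Icc 0 1 := by
  refine Set.Icc_subset_Icc (fun i => ?_) (fun i => ?_)
  · unfold lcb; split_ifs <;> simp
  · unfold ucb; split_ifs <;> simp

/-- For nondecreasing rewards the optimistic index is `f(x, U)`. -/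
theorem index_eq_of_monotone {d : ℕ} {𝒳 : Finset (BVec d)} {f : Reward d}
    (hf : IsMonotoneReward 𝒳 f) (h : History d) {x : BVec d} (hx : x ∈ 𝒳) :
    index f h x = f x (ucb h) := by
  have hmem : ucb h ∈ Set.Icc (lcb h) (ucb h) := ⟨lcb_le_ucb h, le_rfl⟩
  refine IsGreatest.csSup_eq ⟨⟨_, hmem, rfl⟩, ?_⟩
  rintro _ ⟨u, hu, rfl⟩
  exact hf x hx (Icc_lcb_ucb_subset h hu) (Icc_lcb_ucb_subset h hmem) hu.2

theorem decisionLaw_support {d : ℕ} {𝒳 : Finset (BVec d)} {π : Policy d}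
    (hπ : ∀ h, ∀ x ∈ (π h).support, x ∈ 𝒳) (θ : Param d) (t : ℕ) {x : BVec d}
    (hx : x ∉ 𝒳) : decisionLaw π θ t x = 0 := by
  rw [PMF.apply_eq_zero_iff]
  intro hmem
  obtain ⟨h, -, hh⟩ := (PMF.mem_support_bind_iff _ _ _).1 hmem
  exact hx (hπ h x hh)

/-- If `f(x, θ)` is the expectation of `f(x, Z)`, the regret is
`T max_x E f(x, Z(t)) - ∑_t E f(x(t), Z(t))`, where `Z(t)` is independent of `x(t)`. -/
theorem regret_eq_of_isMeanReward {d : ℕ} {𝒳 : Finset (BVec d)} {f : Reward d}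
    (hf : IsMeanReward 𝒳 f) (π : Policy d) (hπ : ∀ h, ∀ x ∈ (π h).support, x ∈ 𝒳)
    (θ : Param d) (T : ℕ) :
    regret 𝒳 f π θ T = T * (⨆ x : {x // x ∈ 𝒳}, outcomeReward f θ x.1)
      - ∑ t ∈ Finset.range T, ∑ x, ∑ z,
          (decisionLaw π θ t x).toReal * (outcomeLaw θ z).toReal * f x z.toReal := by
  unfold regret
  congr 1
  · congr 1
    exact iSup_congr fun x => (hf x.1 x.2 θ).symm
  · refine Finset.sum_congr rfl fun t _ => Finset.sum_congr rfl fun x _ => ?_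
    by_cases hx : x ∈ 𝒳
    · rw [← hf x hx θ, outcomeReward, Finset.mul_sum]
      exact Finset.sum_congr rfl fun z _ => (mul_assoc _ _ _).symm
    · simp [decisionLaw_support hπ θ t hx]

theorem maximizers_nonempty {d : ℕ} {𝒳 : Finset (BVec d)} (h𝒳 : 𝒳.Nonempty)
    (r : BVec d → ℝ) : (maximizers 𝒳 r).Nonempty := by
  obtain ⟨x, hx, hmax⟩ := 𝒳.exists_max_image r h𝒳
  exact ⟨x, hx, hmax⟩

theorem exists_isCUCB {d : ℕ} {𝒳 : Finset (BVec d)} (h𝒳 : 𝒳.Nonempty)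
    (𝓕 : Set (Reward d)) : ∃ alg : Algorithm d, IsCUCB 𝒳 𝓕 alg := by
  refine ⟨fun f h => PMF.pure (maximizers_nonempty h𝒳 (index f h)).some, ?_⟩
  intro f _ h x hx
  rw [PMF.mem_support_pure_iff] at hx
  exact hx ▸ (maximizers_nonempty h𝒳 (index f h)).some_mem

instance {d : ℕ} (h : History d) : IsProbabilityMeasure (posterior h) := by
  unfold posterior
  have := fun i : Fin d => isProbabilityMeasureBeta
    (show (0 : ℝ) < successes h i + 1 by positivity)
    (show (0 : ℝ) < failures h i + 1 by positivity)
  infer_instance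

theorem betaMeasure_ae_mem (a b : ℝ) : ∀ᵐ v ∂betaMeasure a b, v ∈ Set.Icc (0 : ℝ) 1 := by
  have hm : Measurable (betaPDF a b) := (measurable_betaPDFReal a b).ennreal_ofReal
  rw [betaMeasure, ae_withDensity_iff hm]
  refine Filter.Eventually.of_forall fun v hv => ⟨?_, ?_⟩
  · by_contra hlt
    exact hv (betaPDF_eq_zero_of_nonpos (not_le.1 hlt).le)
  · by_contra hlt
    exact hv (betaPDF_eq_zero_of_one_le (not_le.1 hlt).le)

theorem posterior_ae_mem {d : ℕ} (h : History d) :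
    ∀ᵐ V ∂posterior h, V ∈ Set.Icc (0 : Fin d → ℝ) 1 := by
  have hp := fun i : Fin d => isProbabilityMeasureBeta
    (show (0 : ℝ) < successes h i + 1 by positivity)
    (show (0 : ℝ) < failures h i + 1 by positivity)
  have : ∀ᵐ V ∂posterior h, ∀ i, V i ∈ Set.Icc (0 : ℝ) 1 :=
    ae_all_iff.2 fun i => (Measure.tendsto_eval_ae_ae (i := i)).eventually
      (betaMeasure_ae_mem _ _)
  filter_upwards [this] with V hV
  exact ⟨fun i => (hV i).1, fun i => (hV i).2⟩

theorem exists_isThompsonSampling {d : ℕ} {𝒳 : Finset (BVec d)} (h𝒳 : 𝒳.Nonempty)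
    {𝓕 : Set (Reward d)} (h𝓕 : 𝓕 ⊆ lipschitzClass 𝒳) :
    ∃ alg : Algorithm d, IsThompsonSampling 𝒳 𝓕 alg := by
  classical
  have key : ∀ f : Reward d, ∀ h : History d, ∃ p : PMF (BVec d), f ∈ 𝓕 →
      ∃ ρ : Measure ((Fin d → ℝ) × BVec d), ρ.fst = posterior h ∧ ρ.snd = p.toMeasure ∧
        ∀ᵐ q ∂ρ, q.2 ∈ maximizers 𝒳 fun x => f x q.1 := by
    intro f h
    by_cases hf : f ∈ 𝓕
    swap
    · exact ⟨PMF.pure fun _ => false, fun h => absurd h hf⟩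
    let c : (Fin d → ℝ) → Fin d → ℝ := fun V i => max 0 (min 1 (V i))
    have hc : ∀ V, c V ∈ Set.Icc (0 : Fin d → ℝ) 1 := fun V =>
      ⟨fun i => le_max_left _ _, fun i => max_le zero_le_one (min_le_left _ _)⟩
    have hcc : Continuous c := by fun_prop
    have hcont : ∀ x ∈ 𝒳, Continuous fun V => f x (c V) := by
      intro x hx
      rw [continuous_iff_continuousAt]
      intro V
      rw [ContinuousAt, tendsto_iff_dist_tendsto_zero]
      have hlim : Tendsto (fun W => ∑ i with x i = true, |c W i - c V i|) (nhds V) (nhds 0) := by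
        have : Continuous fun W => ∑ i with x i = true, |c W i - c V i| := by fun_prop
        simpa using this.tendsto V
      exact squeeze_zero (fun _ => dist_nonneg)
        (fun W => h𝓕 hf x hx _ (hc W) _ (hc V)) hlim
    let S : (Fin d → ℝ) → Finset (BVec d) := fun V =>
      𝒳.filter fun x => ∀ x' ∈ 𝒳, f x' (c V) ≤ f x (c V)
    have hS : ∀ V, (S V).Nonempty := fun V => by
      obtain ⟨x, hx, hm⟩ := maximizers_nonempty h𝒳 fun x => f x (c V)
      exact ⟨x, Finset.mem_filter.2 ⟨hx, hm⟩⟩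
    let tie : Finset (BVec d) → BVec d := fun s => if hs : s.Nonempty then hs.choose else default
    have htie : ∀ V, tie (S V) ∈ S V := fun V => by
      simp only [tie, dif_pos (hS V)]; exact (hS V).choose_spec
    have hSm : ∀ x, MeasurableSet {V | x ∈ S V} := by
      intro x
      by_cases hx : x ∈ 𝒳
      · have : {V | x ∈ S V} = ⋂ x' ∈ 𝒳, {V | f x' (c V) ≤ f x (c V)} := by
          ext V; simp [S, hx]
        rw [this]
        exact Finset.measurableSet_biInter _ fun x' hx' =>
          measurableSet_le (hcont x' hx').measurable (hcont x hx).measurable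
      · have : {V | x ∈ S V} = ∅ := by ext V; simp [S, hx]
        rw [this]; exact MeasurableSet.empty
    have hselm : Measurable fun V => tie (S V) := by
      refine measurable_to_countable' fun y => ?_
      have : (fun V => tie (S V)) ⁻¹' {y}
          = ⋃ s ∈ (Finset.univ.filter fun s => tie s = y), ⋂ x, {V | x ∈ S V ↔ x ∈ s} := by
        ext V
        simp only [Set.mem_preimage, Set.mem_singleton_iff, Finset.mem_filter, Finset.mem_univ,
          true_and, Set.mem_iUnion, Set.mem_iInter, Set.mem_ofPred_eq, exists_prop]
        constructor
        · intro hy; exact ⟨S V, hy, fun x => Iff.rfl⟩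
        · rintro ⟨s, hs, hx⟩
          rw [Finset.ext hx]; exact hs
      rw [this]
      refine Finset.measurableSet_biUnion _ fun s _ => MeasurableSet.iInter fun x => ?_
      by_cases hx : x ∈ s
      · have he : {V | x ∈ S V ↔ x ∈ s} = {V | x ∈ S V} := by ext V; simp [hx]
        rw [he]; exact hSm x
      · have he : {V | x ∈ S V ↔ x ∈ s} = {V | x ∈ S V}ᶜ := by ext V; simp [hx]
        rw [he]; exact (hSm x).compl
    have hpair : Measurable fun V => (V, tie (S V)) := measurable_id.prodMk hselm
    have := Measure.isProbabilityMeasure_map (μ := posterior h) hselm.aemeasurable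
    refine ⟨((posterior h).map fun V => tie (S V)).toPMF, fun _ =>
      ⟨(posterior h).map fun V => (V, tie (S V)), ?_, ?_, ?_⟩⟩
    · rw [Measure.fst_map_prodMk hselm]; exact Measure.map_id
    · rw [Measure.snd_map_prodMk (X := fun V => V) measurable_id, Measure.toPMF_toMeasure]
    · have hG : MeasurableSet {q : (Fin d → ℝ) × BVec d |
          q.1 ∈ Set.Icc (0 : Fin d → ℝ) 1 ∧ q.2 ∈ S q.1} := by
        have : {q : (Fin d → ℝ) × BVec d | q.1 ∈ Set.Icc (0 : Fin d → ℝ) 1 ∧ q.2 ∈ S q.1}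
            = ⋃ x, (Set.Icc (0 : Fin d → ℝ) 1 ∩ {V | x ∈ S V}) ×ˢ {x} := by
          ext ⟨V, x⟩; simp
        rw [this]
        exact MeasurableSet.iUnion fun x =>
          (measurableSet_Icc.inter (hSm x)).prod (measurableSet_singleton x)
      have hae : ∀ᵐ q ∂((posterior h).map fun V => (V, tie (S V))),
          q.1 ∈ Set.Icc (0 : Fin d → ℝ) 1 ∧ q.2 ∈ S q.1 := by
        rw [ae_map_iff hpair.aemeasurable hG]
        filter_upwards [posterior_ae_mem h] with V hV using ⟨hV, htie V⟩
      filter_upwards [hae] with q hq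
      have hcq : c q.1 = q.1 := by
        funext i
        have h0 : 0 ≤ q.1 i := hq.1.1 i
        have h1 : q.1 i ≤ 1 := hq.1.2 i
        simp only [c, min_eq_right h1, max_eq_right h0]
      have h2 := Finset.mem_filter.1 hq.2
      rw [hcq] at h2
      exact h2
  choose alg halg using key
  exact ⟨alg, fun f hf h => halg f h hf⟩

end SemiBandit

open scoped ENNReal

namespace SemiBandit

/-! Thompson Sampling fails because a product of m independent uniform variables is rarely close to
1. Let S be a block of m items that every decision takes entirely or not at all. `needleReward` pays
∏ θ_i over S for the block and 1 - δ otherwise; at θ = (1,…,1) the block is optimal with gap δ.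
Until the block is tried, the posterior on S is the uniform prior. Choosing the block then requires
∏ V_i ≥ 1 - δ, hence V_i ≥ 1 - δ for every i in S, an event of probability at most δ^m
(`thompsonSampling_toMeasure_le`). With δ^m = 1/(2T), a union bound over the T rounds
(`expect_historyLaw_hit_le`) leaves each round an expected loss of at least δ/2, and T δ/2 is of
order T^(1 - 1/m). The reward may depend on T because the minimax regret is a supremum for a fixed
horizon.

CUCB is controlled by optimism. By the Lipschitz property, the gap of the chosen decision is at most
the sum of the interval widths of its items, plus twice the number of intervals that miss their
parameter (`gap_le_of_mem_maximizers`). Misses have summable probability by an exponential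
supermartingale and a union bound over the number of observations (`expect_miss_le`). The widths sum
pathwise to O(√(T log T)) per item, since the k-th selection of an item has width of order √(log T /
k) (`sum_expect_widthBound`, `sum_widthBound_le`).

Since CUCB bounds the optimal regret from above and 1 - 1/m > 1/2 for m ≥ 3, Thompson Sampling is
then not minimax optimal. -/

/-! ### Expectations under a `PMF` -/

/-- The expectation of a nonnegative function under a probability mass function. -/
noncomputable def expect {α : Type*} (p : PMF α) (g : α → ℝ≥0∞) : ℝ≥0∞ := ∑' a, p a * g a

section Expect

variable {α β : Type*}

theorem expect_pure (a : α) (g : α → ℝ≥0∞) : expect (PMF.pure a) g = g a := by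
  unfold expect
  rw [tsum_eq_single a (fun b hb => by simp [PMF.pure_apply_of_ne _ _ hb])]
  simp

theorem expect_bind (p : PMF α) (q : α → PMF β) (g : β → ℝ≥0∞) :
    expect (p.bind q) g = expect p fun a => expect (q a) g := by
  simp only [expect, PMF.bind_apply, ← ENNReal.tsum_mul_left, ← ENNReal.tsum_mul_right]
  rw [ENNReal.tsum_comm]
  simp only [mul_assoc]

theorem expect_const (p : PMF α) (c : ℝ≥0∞) : expect p (fun _ => c) = c := by
  simp [expect, ENNReal.tsum_mul_right]

theorem expect_mono {p : PMF α} {g g' : α → ℝ≥0∞} (h : ∀ a ∈ p.support, g a ≤ g' a) :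
    expect p g ≤ expect p g' := by
  refine ENNReal.tsum_le_tsum fun a => ?_
  by_cases ha : p a = 0
  · simp [ha]
  · exact mul_le_mul_right (h a ha) _

theorem expect_congr {p : PMF α} {g g' : α → ℝ≥0∞} (h : ∀ a ∈ p.support, g a = g' a) :
    expect p g = expect p g' :=
  le_antisymm (expect_mono fun a ha => (h a ha).le) (expect_mono fun a ha => (h a ha).ge)

theorem expect_le_const {p : PMF α} {g : α → ℝ≥0∞} {c : ℝ≥0∞} (h : ∀ a ∈ p.support, g a ≤ c) :
    expect p g ≤ c :=
  (expect_mono h).trans (expect_const p c).le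

theorem expect_add (p : PMF α) (g g' : α → ℝ≥0∞) :
    expect p (fun a => g a + g' a) = expect p g + expect p g' := by
  simp [expect, mul_add, ENNReal.tsum_add]

theorem expect_const_mul (p : PMF α) (c : ℝ≥0∞) (g : α → ℝ≥0∞) :
    expect p (fun a => c * g a) = c * expect p g := by
  simp only [expect, ← ENNReal.tsum_mul_left, mul_left_comm]

theorem expect_finsetSum {ι : Type*} (p : PMF α) (s : Finset ι) (g : ι → α → ℝ≥0∞) :
    expect p (fun a => ∑ i ∈ s, g i a) = ∑ i ∈ s, expect p (g i) := by
  classical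
  induction s using Finset.induction_on with
  | empty => simp [expect]
  | insert i s hi ih => simp [Finset.sum_insert hi, expect_add, ih]

theorem expect_eq_sum [Fintype α] (p : PMF α) (g : α → ℝ≥0∞) :
    expect p g = ∑ a, p a * g a :=
  tsum_fintype _

/-- Passage between the real finite sums in `regret` and `expect`, whose values in `ℝ≥0∞` spare
summability questions over the infinite type of histories. -/
theorem expect_ofReal [Fintype α] (p : PMF α) {g : α → ℝ} (hg : ∀ a, 0 ≤ g a) :
    expect p (fun a => ENNReal.ofReal (g a)) = ENNReal.ofReal (∑ a, (p a).toReal * g a) := by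
  rw [expect_eq_sum, ENNReal.ofReal_sum_of_nonneg fun a _ => by have := hg a; positivity]
  refine Finset.sum_congr rfl fun a _ => ?_
  rw [ENNReal.ofReal_mul ENNReal.toReal_nonneg, ENNReal.ofReal_toReal (p.apply_ne_top a)]

theorem sum_toReal_eq_one [Fintype α] (p : PMF α) : ∑ a, (p a).toReal = 1 := by
  rw [← ENNReal.toReal_sum fun a _ => p.apply_ne_top a, ← tsum_fintype (L := .unconditional _),
    p.tsum_coe, ENNReal.toReal_one]

end Expect

/-! ### The law of the outcomes -/

variable {d : ℕ}

theorem outcomeLaw_toReal (θ : Param d) (z : BVec d) :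
    (outcomeLaw θ z).toReal = ∏ i, if z i then (θ i : ℝ) else 1 - θ i := by
  rw [outcomeLaw, Measure.toPMF_apply, Measure.pi_singleton, ENNReal.toReal_prod]
  refine Finset.prod_congr rfl fun i _ => ?_
  change (bernoulliMeasure true false (θ i)).real {z i} = _
  rw [bernoulliMeasure_real_apply _ (measurableSet_singleton _)]
  cases z i <;> simp

theorem sum_outcomeLaw_prod (θ : Param d) (g : Fin d → Bool → ℝ) :
    ∑ z, (outcomeLaw θ z).toReal * ∏ i, g i (z i)
      = ∏ i, ((θ i : ℝ) * g i true + (1 - θ i) * g i false) := by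
  have h := Finset.prod_univ_sum (fun _ : Fin d => (Finset.univ : Finset Bool))
    fun i b => (if b then (θ i : ℝ) else 1 - θ i) * g i b
  simp only [Fintype.sum_bool, Fintype.piFinset_univ, if_true, Bool.false_eq_true, if_false] at h
  rw [h]
  exact Finset.sum_congr rfl fun z _ => by rw [outcomeLaw_toReal, Finset.prod_mul_distrib]

theorem sum_outcomeLaw_apply (θ : Param d) (i : Fin d) (g : Bool → ℝ) :
    ∑ z, (outcomeLaw θ z).toReal * g (z i) = (θ i : ℝ) * g true + (1 - θ i) * g false := by
  have h := sum_outcomeLaw_prod θ fun j b => if j = i then g b else 1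
  simp only [Finset.prod_ite_eq', Finset.mem_univ, if_true] at h
  rw [h, Finset.prod_eq_single i]
  · simp
  · intro j _ hj; simp [hj]
  · simp

/-- Hoeffding's lemma for a Bernoulli variable. -/
theorem bernoulli_mgf_le (p : unitInterval) (l : ℝ) :
    (p : ℝ) * Real.exp (l * (1 - p)) + (1 - p) * Real.exp (l * (0 - p))
      ≤ Real.exp (l ^ 2 / 8) := by
  -- An interval of length 1 gives variance proxy 1/4, hence the exponent l²/8.
  have hs := hasSubgaussianMGF_of_mem_Icc (μ := bernoulliMeasure (1 : ℝ) 0 p) (X := id)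
    (a := 0) (b := 1) aemeasurable_id (by
      rw [ae_iff, bernoulliMeasure_apply]
      · simp
      · exact measurableSet_Icc.compl)
  have := hs.mgf_le l
  simp only [mgf, integral_bernoulliMeasure, id, smul_eq_mul] at this
  convert! this using 1
  · simp
  · norm_num; ring

/-! ### The history process -/

theorem expect_historyLaw_zero (π : Policy d) (θ : Param d) (g : History d → ℝ≥0∞) :
    expect (historyLaw π θ 0) g = g [] :=
  expect_pure _ _

theorem expect_historyLaw_succ (π : Policy d) (θ : Param d) (t : ℕ) (g : History d → ℝ≥0∞) :
    expect (historyLaw π θ (t + 1)) g = expect (historyLaw π θ t) fun h =>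
      expect (π h) fun x => expect (outcomeLaw θ) fun z => g ((x, x.mask z) :: h) := by
  simp only [historyLaw, expect_bind, expect_pure]

theorem expect_decisionLaw (π : Policy d) (θ : Param d) (t : ℕ) (g : BVec d → ℝ≥0∞) :
    expect (decisionLaw π θ t) g = expect (historyLaw π θ t) fun h => expect (π h) g :=
  expect_bind _ _ _

theorem regret_eq_sum_gap {𝒳 : Finset (BVec d)} (f : Reward d) (π : Policy d) (θ : Param d)
    (T : ℕ) : regret 𝒳 f π θ T = ∑ t ∈ Finset.range T, ∑ x, (decisionLaw π θ t x).toReal *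
      ((⨆ x : {x // x ∈ 𝒳}, f x.1 θ.toReal) - f x θ.toReal) := by
  simp only [regret, mul_sub, Finset.sum_sub_distrib, ← Finset.sum_mul, sum_toReal_eq_one]
  simp

theorem le_minimaxRegret {𝒳 : Finset (BVec d)} {𝓕 : Set (Reward d)} {alg : Algorithm d}
    {f : Reward d} (hf : f ∈ 𝓕) (θ : Param d) (T : ℕ) :
    (regret 𝒳 f (alg f) θ T : EReal) ≤ minimaxRegret 𝒳 𝓕 alg T :=
  (le_iSup (fun θ : Param d => (regret 𝒳 f (alg f) θ T : EReal)) θ).trans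
    (le_iSup₂ (f := fun f _ => ⨆ θ : Param d, (regret 𝒳 f (alg f) θ T : EReal)) f hf)

/-! ### Thompson Sampling -/

/-- The posterior of an unobserved item is uniform. -/
theorem betaMeasure_one_one_Ici (a : ℝ) :
    betaMeasure 1 1 (Set.Ici a) ≤ ENNReal.ofReal (1 - a) := by
  rw [betaMeasure, withDensity_apply _ measurableSet_Ici]
  calc ∫⁻ v in Set.Ici a, betaPDF 1 1 v
      ≤ ∫⁻ v in Set.Ici a, (Set.Icc a 1).indicator 1 v := by
        refine setLIntegral_mono' measurableSet_Ici fun v hv => ?_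
        by_cases hv1 : v ≤ 1
        · rw [Set.indicator_of_mem (show v ∈ Set.Icc a 1 from ⟨hv, hv1⟩), betaPDF_eq]
          split_ifs <;> simp [beta, one_add_one_eq_two]
        · rw [betaPDF_eq_zero_of_one_le (not_le.1 hv1).le]; exact bot_le
    _ ≤ ∫⁻ v, (Set.Icc a 1).indicator 1 v := setLIntegral_le_lintegral _ _
    _ = ENNReal.ofReal (1 - a) := by
        rw [lintegral_indicator_one measurableSet_Icc, Real.volume_Icc]

/-- The posterior probability that all items of `S` are near `1` if none was observed. -/
theorem posterior_all_ge_le {S : Finset (Fin d)} {h : History d}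
    (hS : ∀ p ∈ h, ∀ i ∈ S, p.1 i = false) {δ : ℝ} (hδ : 0 ≤ δ) :
    posterior h {V | ∀ i ∈ S, 1 - δ ≤ V i} ≤ ENNReal.ofReal (δ ^ S.card) := by
  classical
  have hp := fun i : Fin d => isProbabilityMeasureBeta
    (show (0 : ℝ) < successes h i + 1 by positivity)
    (show (0 : ℝ) < failures h i + 1 by positivity)
  -- The event is a box, so its product measure factors; coordinates outside S contribute 1.
  have hset : {V : Fin d → ℝ | ∀ i ∈ S, 1 - δ ≤ V i}
      = Set.univ.pi fun i => if i ∈ S then Set.Ici (1 - δ) else Set.univ := by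
    ext V
    simp only [Set.mem_ofPred_eq, Set.mem_pi, Set.mem_univ, true_implies]
    refine forall_congr' fun i => ?_
    split_ifs with hi <;> simp [hi]
  rw [hset, posterior, Measure.pi_pi, ENNReal.ofReal_pow hδ, ← Finset.prod_const,
    ← Finset.prod_subset (Finset.subset_univ S)]
  · refine Finset.prod_le_prod' fun i hi => ?_
    have h0 : successes h i = 0 := by
      simp only [successes, List.countP_eq_zero]
      intro p hp; simp [hS p hp i hi]
    have h1 : failures h i = 0 := by
      simp only [failures, List.countP_eq_zero]
      intro p hp; simp [hS p hp i hi]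
    rw [if_pos hi, h0, h1]
    simpa using betaMeasure_one_one_Ici (1 - δ)
  · intro i _ hi
    simp [hi]

/-- The reward `∏_{i ∈ S} θ_i` for decisions that select an item of `S`, and the constant `c`
for all other decisions. -/
noncomputable def needleReward (S : Finset (Fin d)) (c : ℝ) : Reward d := fun x u =>
  if ∃ i ∈ S, x i = true then ∏ i ∈ S, u i else c

/-- Exchange the factors one at a time: the others lie in [0,1], so each exchange costs at most |u i
- v i|. -/
theorem abs_prod_sub_prod_le (S : Finset (Fin d)) {u v : Fin d → ℝ}
    (hu : u ∈ Set.Icc 0 1) (hv : v ∈ Set.Icc 0 1) :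
    |∏ i ∈ S, u i - ∏ i ∈ S, v i| ≤ ∑ i ∈ S, |u i - v i| := by
  classical
  induction S using Finset.induction_on with
  | empty => simp
  | insert i s hi ih =>
    rw [Finset.prod_insert hi, Finset.prod_insert hi, Finset.sum_insert hi]
    have hvi : |v i| ≤ 1 := by rw [abs_of_nonneg (hv.1 i)]; exact hv.2 i
    have hp : |∏ j ∈ s, u j| ≤ 1 := by
      rw [abs_of_nonneg (Finset.prod_nonneg fun j _ => hu.1 j)]
      exact Finset.prod_le_one (fun j _ => hu.1 j) fun j _ => hu.2 j
    calc |u i * ∏ j ∈ s, u j - v i * ∏ j ∈ s, v j|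
        = |(u i - v i) * ∏ j ∈ s, u j + v i * (∏ j ∈ s, u j - ∏ j ∈ s, v j)| := by ring_nf
      _ ≤ |u i - v i| * |∏ j ∈ s, u j| + |v i| * |∏ j ∈ s, u j - ∏ j ∈ s, v j| := by
          rw [← abs_mul, ← abs_mul]; exact abs_add_le _ _
      _ ≤ |u i - v i| * 1 + 1 * ∑ j ∈ s, |u j - v j| := by gcongr
      _ = _ := by ring

/-- Because a decision meeting S contains S, the product involves selected items only, as the
Lipschitz bound demands. The mean property is independence: the product is affine in each
coordinate. -/
theorem needleReward_mem_regularClass {𝒳 : Finset (BVec d)} {S : Finset (Fin d)}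
    (h𝒳 : ∀ x ∈ 𝒳, (∃ i ∈ S, x i = true) → ∀ i ∈ S, x i = true) (c : ℝ) :
    needleReward S c ∈ regularClass 𝒳 := by
  classical
  refine ⟨fun x hx u hu v hv => ?_, fun x _ u hu v hv huv => ?_, fun x _ θ => ?_⟩
  · unfold needleReward
    split_ifs with h
    · refine (abs_prod_sub_prod_le S hu hv).trans ?_
      refine Finset.sum_le_sum_of_subset_of_nonneg (fun i hi => ?_) fun _ _ _ => abs_nonneg _
      simpa using h𝒳 x hx h i hi
    · simpa using Finset.sum_nonneg fun i _ => abs_nonneg (u i - v i)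
  · unfold needleReward
    split_ifs with h
    · exact Finset.prod_le_prod (fun i _ => hu.1 i) fun i _ => huv i
    · exact le_rfl
  · unfold outcomeReward needleReward
    split_ifs with h
    · have := sum_outcomeLaw_prod θ fun i b => if i ∈ S then (if b then 1 else 0) else 1
      simp only [Finset.prod_ite_mem, Finset.univ_inter] at this
      refine (Eq.trans ?_ this).trans ?_
      · rfl
      · rw [← Finset.prod_subset (Finset.subset_univ S)]
        · exact Finset.prod_congr rfl fun i hi => by simp [hi, Param.toReal]
        · intro i _ hi; simp [hi]
    · rw [← Finset.sum_mul, sum_toReal_eq_one, one_mul]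

/-- As long as no item of `S` was selected, Thompson Sampling selects one with small
probability. -/
theorem thompsonSampling_toMeasure_le {𝒳 : Finset (BVec d)} {𝓕 : Set (Reward d)}
    {TS : Algorithm d} (hTS : IsThompsonSampling 𝒳 𝓕 TS) {S : Finset (Fin d)}
    {δ : ℝ} (hδ : 0 ≤ δ) (hf : needleReward S (1 - δ) ∈ 𝓕)
    (h0 : ∃ x ∈ 𝒳, ∀ i ∈ S, x i = false)
    {h : History d} (hS : ∀ p ∈ h, ∀ i ∈ S, p.1 i = false) :
    (TS (needleReward S (1 - δ)) h).toMeasure {x | ∃ i ∈ S, x i = true}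
      ≤ ENNReal.ofReal (δ ^ S.card) := by
  classical
  obtain ⟨ρ, h1, h2, h3⟩ := hTS _ hf h
  obtain ⟨x₀, hx₀, hx₀S⟩ := h0
  have hmeas : MeasurableSet {V : Fin d → ℝ | ∀ i ∈ S, 1 - δ ≤ V i} := by
    have : {V : Fin d → ℝ | ∀ i ∈ S, 1 - δ ≤ V i} = ⋂ i ∈ S, {V | 1 - δ ≤ V i} := by
      ext V; simp
    rw [this]
    exact Finset.measurableSet_biInter _ fun i _ =>
      measurableSet_le measurable_const (measurable_pi_apply i)
  have hI : ∀ᵐ p ∂ρ, p.1 ∈ Set.Icc (0 : Fin d → ℝ) 1 := by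
    have := posterior_ae_mem h
    rw [← h1] at this
    exact ae_of_ae_map measurable_fst.aemeasurable this
  rw [← h2, Measure.snd_apply (Set.toFinite _).measurableSet]
  refine le_trans (measure_mono_ae ?_)
    ((Measure.fst_apply hmeas).symm.trans_le (h1 ▸ posterior_all_ge_le hS hδ))
  filter_upwards [h3, hI] with p hp hpI hpx i hi
  -- A maximizer that meets S must beat the sure reward 1 - δ of x₀. A product of numbers in [0,1]
  -- is at most each of its factors, so every sampled coordinate in S is at least 1 - δ.
  have hle := hp.2 x₀ hx₀
  have e0 : ¬ ∃ i ∈ S, x₀ i = true := by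
    rintro ⟨i, hi, h⟩; simp [hx₀S i hi] at h
  simp only [needleReward, if_neg e0] at hle
  rw [if_pos (show ∃ i ∈ S, p.2 i = true from hpx)] at hle
  refine hle.trans ?_
  rw [← Finset.mul_prod_erase S _ hi]
  exact mul_le_of_le_one_right (hpI.1 i)
    (Finset.prod_le_one (fun j _ => hpI.1 j) fun j _ => hpI.2 j)

open Classical in
/-- A policy that, as long as no decision in `H` was taken, takes one with probability at most
`p`, takes none within `t` rounds with probability at least `1 - t p`. -/
theorem expect_historyLaw_hit_le (π : Policy d) (θ : Param d) (H : Set (BVec d)) (p : ℝ≥0∞)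
    (hp : ∀ h : History d, (∀ q ∈ h, q.1 ∉ H) → (π h).toMeasure H ≤ p) (t : ℕ) :
    expect (historyLaw π θ t) (fun h => if ∃ q ∈ h, q.1 ∈ H then 1 else 0) ≤ t * p ∧
      expect (decisionLaw π θ t) (fun x => if x ∈ H then 1 else 0) ≤ (t + 1) * p := by
  have hmeas : ∀ h : History d, expect (π h) (fun x => if x ∈ H then 1 else 0)
      = (π h).toMeasure H := fun h => by
    rw [PMF.toMeasure_apply_eq_toOuterMeasure_apply _ (Set.toFinite H).measurableSet,
      PMF.toOuterMeasure_apply]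
    exact tsum_congr fun x => by by_cases hx : x ∈ H <;> simp [hx]
  -- Valid for every history: after a hit the indicator already pays the trivial bound 1.
  have hstep : ∀ h : History d, expect (π h) (fun x => if x ∈ H then 1 else 0)
      ≤ (if ∃ q ∈ h, q.1 ∈ H then 1 else 0) + p := by
    intro h
    rw [hmeas]
    split_ifs with hh
    · refine le_add_right ?_
      rw [← hmeas]
      exact expect_le_const fun x _ => by split_ifs <;> simp
    · rw [zero_add]
      exact hp h fun q hq hqH => hh ⟨q, hq, hqH⟩
  have hfirst : ∀ t : ℕ,
      expect (historyLaw π θ t) (fun h => if ∃ q ∈ h, q.1 ∈ H then 1 else 0) ≤ t * p := by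
    intro t
    induction t with
    | zero => simp [expect_historyLaw_zero]
    | succ t ih =>
      rw [expect_historyLaw_succ]
      calc _ ≤ expect (historyLaw π θ t) fun h => (if ∃ q ∈ h, q.1 ∈ H then 1 else 0) + p := by
            refine expect_mono fun h _ => ?_
            by_cases hh : ∃ q ∈ h, q.1 ∈ H
            · rw [if_pos hh]
              refine le_add_right (expect_le_const fun x _ => expect_le_const fun z _ => ?_)
              split_ifs <;> simp
            · refine le_trans (expect_mono fun x _ => ?_) (hstep h)
              refine expect_le_const fun z _ => ?_
              simp only [List.mem_cons, exists_eq_or_imp, hh, or_false]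
              exact le_rfl
        _ ≤ t * p + p := by
            rw [expect_add, expect_const]; gcongr
        _ = _ := by push_cast; ring
  refine ⟨hfirst t, ?_⟩
  rw [expect_decisionLaw]
  calc _ ≤ expect (historyLaw π θ t) fun h => (if ∃ q ∈ h, q.1 ∈ H then 1 else 0) + p :=
        expect_mono fun h _ => hstep h
    _ ≤ t * p + p := by rw [expect_add, expect_const]; gcongr; exact hfirst t
    _ = _ := by ring

theorem iSup_eq_of_isGreatest {𝒳 : Finset (BVec d)} {f : BVec d → ℝ} {x : BVec d} (hx : x ∈ 𝒳)
    (h : ∀ y ∈ 𝒳, f y ≤ f x) : ⨆ x : {x // x ∈ 𝒳}, f x.1 = f x := by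
  have : Nonempty {x // x ∈ 𝒳} := ⟨⟨x, hx⟩⟩
  exact le_antisymm (ciSup_le fun y => h y.1 y.2)
    (le_ciSup (f := fun x : {x // x ∈ 𝒳} => f x.1) (Set.finite_range _).bddAbove ⟨x, hx⟩)

/-- If `𝒳` consists of decisions that select all items of `S` and of decisions that select none
of them, the minimax regret of Thompson Sampling is of order at least `T ^ (1 - 1 / |S|)`. -/
theorem thompsonSampling_minimaxRegret_ge {𝒳 : Finset (BVec d)} {S : Finset (Fin d)}
    (hS : S.Nonempty) (h𝒳 : ∀ x ∈ 𝒳, (∃ i ∈ S, x i = true) → ∀ i ∈ S, x i = true)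
    (h0 : ∃ x ∈ 𝒳, ∀ i ∈ S, x i = false) (h1 : ∃ x ∈ 𝒳, ∃ i ∈ S, x i = true)
    {𝓕 : Set (Reward d)} (h𝓕 : regularClass 𝒳 ⊆ 𝓕) {TS : Algorithm d}
    (hTS : IsThompsonSampling 𝒳 𝓕 TS) {T : ℕ} (hT : 1 ≤ T) :
    ((1 / 4 * (T : ℝ) ^ (1 - 1 / (S.card : ℝ)) : ℝ) : EReal) ≤ minimaxRegret 𝒳 𝓕 TS T := by
  classical
  have hm : (1 : ℝ) ≤ S.card := by exact_mod_cast hS.card_pos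
  have hT' : (1 : ℝ) ≤ T := by exact_mod_cast hT
  -- Chosen so that δ^|S| = 1/(2T): the union bound over T rounds then gives hit probability at most
  -- 1/2.
  set δ : ℝ := (2 * T : ℝ) ^ (-(1 / (S.card : ℝ))) with hδdef
  have hδ : 0 < δ := by positivity
  have hδ1 : δ ≤ 1 := Real.rpow_le_one_of_one_le_of_nonpos (by linarith) (by simp)
  have hδS : δ ^ S.card = 1 / (2 * T) := by
    rw [hδdef, ← Real.rpow_natCast, ← Real.rpow_mul (by positivity), neg_mul,
      one_div_mul_cancel (by positivity), Real.rpow_neg_one, one_div]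
  set f : Reward d := needleReward S (1 - δ) with hf
  have hf𝓕 : f ∈ 𝓕 := h𝓕 (needleReward_mem_regularClass h𝒳 _)
  set θ : Param d := fun _ => 1
  set H : Set (BVec d) := {x | ∃ i ∈ S, x i = true} with hH
  refine le_trans ?_ (le_minimaxRegret hf𝓕 θ T)
  rw [EReal.coe_le_coe_iff]
  have hfx : ∀ x, f x θ.toReal = if x ∈ H then 1 else 1 - δ := fun x => by
    simp [hf, needleReward, hH, θ, Param.toReal]
  have hsup : (⨆ x : {x // x ∈ 𝒳}, f x.1 θ.toReal) = 1 := by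
    obtain ⟨x₁, hx₁, hx₁S⟩ := h1
    rw [iSup_eq_of_isGreatest (f := fun x => f x θ.toReal) hx₁]
    · simp only [hfx]; exact if_pos hx₁S
    · intro y _
      simp only [hfx]
      rw [if_pos (show x₁ ∈ H from hx₁S)]
      split_ifs <;> linarith
  have hround : ∀ t ∈ Finset.range T, δ / 2 ≤ ∑ x, (decisionLaw (TS f) θ t x).toReal *
      ((⨆ x : {x // x ∈ 𝒳}, f x.1 θ.toReal) - f x θ.toReal) := by
    intro t ht
    have hle : expect (decisionLaw (TS f) θ t) (fun x => if x ∈ H then 1 else 0)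
        ≤ (t + 1) * ENNReal.ofReal (δ ^ S.card) := by
      convert! (expect_historyLaw_hit_le (TS f) θ H (ENNReal.ofReal (δ ^ S.card))
      (fun h hh => thompsonSampling_toMeasure_le hTS hδ.le hf𝓕 h0
        fun p hp i hi => by
          by_contra hne
          exact hh p hp ⟨i, hi, by simpa using hne⟩) t).2
    have hcast : expect (decisionLaw (TS f) θ t) (fun x => if x ∈ H then 1 else 0)
        = ENNReal.ofReal (∑ x, (decisionLaw (TS f) θ t x).toReal * if x ∈ H then 1 else 0) := by
      rw [← expect_ofReal _ fun x => by split_ifs <;> simp]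
      exact expect_congr fun x _ => by split_ifs <;> simp
    rw [hcast, show ((t : ℝ≥0∞) + 1) = ENNReal.ofReal (t + 1) by
        rw [ENNReal.ofReal_add (by positivity) (by positivity)]; simp,
      ← ENNReal.ofReal_mul (by positivity), hδS,
      ENNReal.ofReal_le_ofReal_iff (by positivity)] at hle
    have ht' : (t : ℝ) + 1 ≤ T := by exact_mod_cast Finset.mem_range.1 ht
    have hhalf : ((t : ℝ) + 1) * (1 / (2 * T)) ≤ 1 / 2 := by
      rw [mul_one_div, div_le_div_iff₀ (by positivity) (by positivity)]; linarith
    have hgap : ∑ x, (decisionLaw (TS f) θ t x).toReal *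
        ((⨆ x : {x // x ∈ 𝒳}, f x.1 θ.toReal) - f x θ.toReal)
        = δ * (1 - ∑ x, (decisionLaw (TS f) θ t x).toReal * if x ∈ H then 1 else 0) := by
      calc _ = δ * (∑ x, (decisionLaw (TS f) θ t x).toReal
            - ∑ x, (decisionLaw (TS f) θ t x).toReal * if x ∈ H then 1 else 0) := by
            rw [← Finset.sum_sub_distrib, Finset.mul_sum]
            refine Finset.sum_congr rfl fun x _ => ?_
            rw [hsup, hfx]
            split_ifs <;> ring
        _ = _ := by rw [sum_toReal_eq_one]
    rw [hgap]
    nlinarith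
  rw [regret_eq_sum_gap]
  refine le_trans ?_ (Finset.card_nsmul_le_sum _ _ _ hround)
  rw [Finset.card_range, nsmul_eq_mul]
  have hsplit : δ = (2 : ℝ) ^ (-(1 / (S.card : ℝ))) * (T : ℝ) ^ (-(1 / (S.card : ℝ))) :=
    Real.mul_rpow (by norm_num) (by positivity)
  -- Together with the factor 1/2 from the hit probability, this gives the constant 1/4.
  have h2 : (1 / 2 : ℝ) ≤ (2 : ℝ) ^ (-(1 / (S.card : ℝ))) := by
    rw [one_div, ← Real.rpow_neg_one]
    refine Real.rpow_le_rpow_of_exponent_le (by norm_num) (neg_le_neg ?_)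
    rw [div_le_one (by positivity)]; exact hm
  have hTp : (T : ℝ) ^ (1 - 1 / (S.card : ℝ)) = T * (T : ℝ) ^ (-(1 / (S.card : ℝ))) := by
    rw [sub_eq_add_neg, Real.rpow_add (by positivity), Real.rpow_one]
  rw [hTp, hsplit]
  have hpos : 0 ≤ (T : ℝ) * (T : ℝ) ^ (-(1 / (S.card : ℝ))) := by positivity
  nlinarith

/-! ### Counting selections and successes -/

theorem pulls_cons (x o : BVec d) (h : History d) (i : Fin d) :
    pulls ((x, o) :: h) i = pulls h i + if x i = true then 1 else 0 := by
  simp [pulls, List.countP_cons]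

theorem successes_cons_mask (x z : BVec d) (h : History d) (i : Fin d) :
    successes ((x, x.mask z) :: h) i
      = successes h i + if x i = true then (if z i = true then 1 else 0) else 0 := by
  cases hx : x i <;> cases hz : z i <;> simp [successes, BVec.mask, hx, hz]

theorem length_of_mem_support {π : Policy d} {θ : Param d} {t : ℕ} {h : History d}
    (hh : h ∈ (historyLaw π θ t).support) : h.length = t := by
  induction t generalizing h with
  | zero =>
    rw [historyLaw, PMF.mem_support_pure_iff] at hh
    simp [hh]
  | succ t ih =>
    simp only [historyLaw, PMF.mem_support_bind_iff, PMF.mem_support_pure_iff] at hh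
    obtain ⟨h', hh', x, -, z, -, rfl⟩ := hh
    simp [ih hh']

theorem pulls_le_length (h : History d) (i : Fin d) : pulls h i ≤ h.length :=
  List.countP_le_length

/-! ### Concentration of the empirical means -/

/-- The exponential supermartingale of the successes of item `i`. -/
noncomputable def expSupermart (θ : Param d) (i : Fin d) (l : ℝ) (h : History d) : ℝ :=
  Real.exp (l * (successes h i - pulls h i * θ i) - pulls h i * (l ^ 2 / 8))

/-- An observation of item i multiplies the process by exp(l (Z_i - θ_i) - l²/8), of mean at most 1
by Hoeffding's lemma; other rounds leave it unchanged. The bound holds for each decision x, so the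
policy may be adaptive. -/
theorem expect_expSupermart_cons_le (θ : Param d) (i : Fin d) (l : ℝ) (h : History d)
    (x : BVec d) :
    expect (outcomeLaw θ) (fun z => ENNReal.ofReal (expSupermart θ i l ((x, x.mask z) :: h)))
      ≤ ENNReal.ofReal (expSupermart θ i l h) := by
  by_cases hx : x i = true
  · rw [expect_ofReal _ fun z => show 0 ≤ expSupermart θ i l _ from (Real.exp_pos _).le]
    refine ENNReal.ofReal_le_ofReal ?_
    have hfac : ∀ z : BVec d, expSupermart θ i l ((x, x.mask z) :: h)
        = expSupermart θ i l h * Real.exp (-(l ^ 2 / 8)) *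
          Real.exp (l * ((if z i = true then 1 else 0) - θ i)) := fun z => by
      rw [expSupermart, expSupermart, ← Real.exp_add, ← Real.exp_add, successes_cons_mask,
        pulls_cons]
      congr 1
      simp only [hx, if_true]
      push_cast
      ring
    simp only [hfac]
    have hsum := sum_outcomeLaw_apply θ i
      fun b => expSupermart θ i l h * Real.exp (-(l ^ 2 / 8)) *
        Real.exp (l * ((if b = true then 1 else 0) - θ i))
    rw [hsum]
    simp only [if_true, Bool.false_eq_true, if_false]
    have hpos : 0 ≤ expSupermart θ i l h * Real.exp (-(l ^ 2 / 8)) :=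
      mul_nonneg (Real.exp_pos _).le (Real.exp_pos _).le
    calc _ = expSupermart θ i l h * Real.exp (-(l ^ 2 / 8)) *
          ((θ i : ℝ) * Real.exp (l * (1 - θ i)) + (1 - θ i) * Real.exp (l * (0 - θ i))) := by
          ring
      _ ≤ expSupermart θ i l h * Real.exp (-(l ^ 2 / 8)) * Real.exp (l ^ 2 / 8) :=
          mul_le_mul_of_nonneg_left (bernoulli_mgf_le _ _) hpos
      _ = _ := by rw [mul_assoc, ← Real.exp_add]; simp
  · refine expect_le_const fun z _ => le_of_eq ?_
    rw [expSupermart, expSupermart, successes_cons_mask, pulls_cons]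
    simp [hx]

theorem expect_expSupermart_le_one (π : Policy d) (θ : Param d) (i : Fin d) (l : ℝ) (t : ℕ) :
    expect (historyLaw π θ t) (fun h => ENNReal.ofReal (expSupermart θ i l h)) ≤ 1 := by
  induction t with
  | zero => simp [expect_historyLaw_zero, expSupermart, successes, pulls]
  | succ t ih =>
    rw [expect_historyLaw_succ]
    refine le_trans (expect_mono fun h _ => ?_) ih
    exact expect_le_const fun x _ => expect_expSupermart_cons_le θ i l h x

/-- The parameter of item `i` lies outside its confidence interval. -/
def Miss (θ : Param d) (i : Fin d) (h : History d) : Prop :=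
  (θ i : ℝ) ∉ Set.Icc (lcb h i) (ucb h i)

/-- If the confidence interval of an item fails, one of the supermartingales is large. -/
theorem pow_le_expSupermart_of_miss {θ : Param d} {i : Fin d} {h : History d}
    (hm : Miss θ i h) : 1 ≤ pulls h i ∧
      ((h.length + 1 : ℝ) ^ 3 ≤ expSupermart θ i (4 * radius h i) h ∨
        (h.length + 1 : ℝ) ^ 3 ≤ expSupermart θ i (-(4 * radius h i)) h) := by
  have hθ0 : (0 : ℝ) ≤ θ i := (θ i).2.1
  have hθ1 : (θ i : ℝ) ≤ 1 := (θ i).2.2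
  have hN : pulls h i ≠ 0 := fun hN => hm (by simp [lcb, ucb, hN])
  have hN1 : 1 ≤ pulls h i := Nat.one_le_iff_ne_zero.2 hN
  refine ⟨hN1, ?_⟩
  have hk : (0 : ℝ) < pulls h i := by exact_mod_cast hN1
  have hlog : 0 ≤ Real.log (h.length + 1) := Real.log_nonneg (by simp)
  have hr0 : 0 ≤ radius h i := Real.sqrt_nonneg _
  -- With N = `pulls h i` and r the radius, the tilt l = 4r maximizes l N r - N l²/8; the maximum is
  -- 2 N r² = 3 log(length + 1), the source of the cube.
  have hr2 : (pulls h i : ℝ) * radius h i ^ 2 = 3 / 2 * Real.log (h.length + 1) := by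
    rw [radius, Real.sq_sqrt (by positivity)]
    field_simp
  have hpow : (h.length + 1 : ℝ) ^ 3 = Real.exp (3 * Real.log (h.length + 1)) := by
    rw [mul_comm, Real.exp_mul, Real.exp_log (by positivity)]
    norm_cast
  have hmean : empMean h i * pulls h i = successes h i := by
    rw [empMean]; field_simp
  simp only [hpow, expSupermart, Real.exp_le_exp]
  rw [Miss, Set.mem_Icc, not_and_or] at hm
  simp only [lcb, ucb, if_neg hN, not_le, lt_max_iff, min_lt_iff] at hm
  rcases hm with hm | hm
  · left
    have h1 : radius h i ≤ empMean h i - θ i := by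
      -- The alternative created by clipping the interval contradicts θ i ∈ [0,1].
      rcases hm with hm | hm <;> linarith
    have h2 : (pulls h i : ℝ) * radius h i ≤ successes h i - pulls h i * θ i := by
      rw [← hmean]; nlinarith
    nlinarith [mul_le_mul_of_nonneg_left h2 hr0]
  · right
    have h1 : radius h i ≤ θ i - empMean h i := by
      rcases hm with hm | hm <;> linarith
    have h2 : (pulls h i : ℝ) * radius h i ≤ pulls h i * θ i - successes h i := by
      rw [← hmean]; nlinarith
    nlinarith [mul_le_mul_of_nonneg_left h2 hr0]

-- The tilt in `pow_le_expSupermart_of_miss` depends on the random number of observations, so the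
-- supermartingales are summed over its possible values k = 1, …, n. Markov's inequality gives
-- 2n/(n+1)³, which is weakened to a telescoping form via n(n+2) ≤ (n+1)².
open Classical in
theorem expect_miss_le (π : Policy d) (θ : Param d) (i : Fin d) (n : ℕ) :
    expect (historyLaw π θ n) (fun h => if Miss θ i h then 1 else 0)
      ≤ ENNReal.ofReal (2 * (1 / (n + 1) - 1 / (n + 2))) := by
  set r : ℕ → ℝ := fun k => √(3 * Real.log (n + 1) / (2 * k)) with hr
  set c : ℝ≥0∞ := ENNReal.ofReal (1 / (n + 1) ^ 3) with hc
  have hpt : ∀ h ∈ (historyLaw π θ n).support, (if Miss θ i h then (1 : ℝ≥0∞) else 0)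
      ≤ ∑ k ∈ Finset.Icc 1 n, c * (ENNReal.ofReal (expSupermart θ i (4 * r k) h)
        + ENNReal.ofReal (expSupermart θ i (-(4 * r k)) h)) := by
    intro h hh
    have hlen := length_of_mem_support hh
    split_ifs with hm
    swap
    · exact bot_le
    obtain ⟨h1, h2⟩ := pow_le_expSupermart_of_miss hm
    have hmem : pulls h i ∈ Finset.Icc 1 n :=
      Finset.mem_Icc.2 ⟨h1, hlen ▸ pulls_le_length h i⟩
    refine le_trans ?_ (Finset.single_le_sum (fun _ _ => bot_le) hmem)
    have hrad : r (pulls h i) = radius h i := by simp only [hr, radius, hlen]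
    rw [hrad, hlen] at *
    have hone : ∀ y : ℝ, ((n : ℝ) + 1) ^ 3 ≤ y → 1 ≤ c * ENNReal.ofReal y := fun y hy => by
      rw [hc, ← ENNReal.ofReal_mul (by positivity), ENNReal.one_le_ofReal, one_div_mul_eq_div,
        one_le_div (by positivity)]
      exact hy
    rw [mul_add]
    rcases h2 with h2 | h2
    · exact le_add_right (hone _ h2)
    · exact le_add_left (hone _ h2)
  refine (expect_mono hpt).trans ?_
  rw [expect_finsetSum]
  calc _ ≤ ∑ k ∈ Finset.Icc 1 n, c * 2 := by
        refine Finset.sum_le_sum fun k _ => ?_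
        rw [expect_const_mul, expect_add]
        refine mul_le_mul_right ?_ c
        exact (add_le_add (expect_expSupermart_le_one _ _ _ _ _)
          (expect_expSupermart_le_one _ _ _ _ _)).trans one_add_one_eq_two.le
    _ = ENNReal.ofReal (n * (1 / (n + 1) ^ 3 * 2)) := by
        rw [Finset.sum_const, Nat.card_Icc, Nat.add_sub_cancel, nsmul_eq_mul,
          ENNReal.ofReal_mul (by positivity), ENNReal.ofReal_mul (by positivity),
          ENNReal.ofReal_natCast, ENNReal.ofReal_ofNat]
    _ ≤ _ := by
        refine ENNReal.ofReal_le_ofReal ?_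
        rw [div_sub_div _ _ (by positivity) (by positivity), one_div_mul_eq_div, ← mul_div_assoc,
          ← mul_div_assoc, div_le_div_iff₀ (by positivity) (by positivity)]
        have : (0 : ℝ) ≤ n := by positivity
        nlinarith [pow_nonneg this 2, pow_nonneg this 3]

theorem sum_telescope_le (T : ℕ) :
    ∑ n ∈ Finset.range T, 2 * (1 / ((n : ℝ) + 1) - 1 / (n + 2)) ≤ 2 := by
  rw [← Finset.mul_sum]
  have h := Finset.sum_range_sub' (fun n : ℕ => 1 / ((n : ℝ) + 1)) T
  have h' : ∑ n ∈ Finset.range T, (1 / ((n : ℝ) + 1) - 1 / (n + 2))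
      = 1 - 1 / ((T : ℝ) + 1) := by
    rw [← Finset.sum_congr rfl fun (n : ℕ) _ => ?_] at h
    · rw [h]; simp
    · push_cast; ring
  rw [h']
  have : 0 ≤ 1 / ((T : ℝ) + 1) := by positivity
  linarith

/-! ### The width of the confidence intervals -/

/-- A bound on the width of the confidence interval of an item observed `k` times. -/
noncomputable def widthBound (L : ℝ) (k : ℕ) : ℝ := (if k = 0 then 1 else 0) + L * (√k)⁻¹

theorem widthBound_nonneg {L : ℝ} (hL : 0 ≤ L) (k : ℕ) : 0 ≤ widthBound L k := by
  unfold widthBound; positivity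

theorem sum_inv_sqrt_le (n : ℕ) : ∑ k ∈ Finset.range (n + 1), (√(k : ℝ))⁻¹ ≤ 2 * √n := by
  induction n with
  | zero => simp
  | succ n ih =>
    rw [Finset.sum_range_succ]
    have hs : 0 < √((n + 1 : ℕ) : ℝ) := Real.sqrt_pos.2 (by positivity)
    have hsq : √((n + 1 : ℕ) : ℝ) ^ 2 = n + 1 := by rw [Real.sq_sqrt (by positivity)]; simp
    have hn : √(n : ℝ) ^ 2 = n := Real.sq_sqrt (by positivity)
    have : (√((n + 1 : ℕ) : ℝ))⁻¹ ≤ 2 * √((n + 1 : ℕ) : ℝ) - 2 * √n := by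
      rw [inv_le_iff_one_le_mul₀ hs]
      -- As the two roots have squares differing by 1, the claim is exactly the nonnegativity of
      -- this square.
      nlinarith [sq_nonneg (√((n + 1 : ℕ) : ℝ) - √n)]
    linarith

theorem sum_widthBound_le {L : ℝ} (hL : 0 ≤ L) {n T : ℕ} (h : n ≤ T) :
    ∑ k ∈ Finset.range n, widthBound L k ≤ 1 + L * (2 * √T) := by
  calc ∑ k ∈ Finset.range n, widthBound L k ≤ ∑ k ∈ Finset.range (T + 1), widthBound L k :=
        Finset.sum_le_sum_of_subset_of_nonneg (Finset.range_mono (h.trans T.le_succ))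
          fun k _ _ => widthBound_nonneg hL k
    _ = 1 + L * ∑ k ∈ Finset.range (T + 1), (√(k : ℝ))⁻¹ := by
        simp [widthBound, Finset.sum_add_distrib, Finset.mul_sum]
    _ ≤ _ := by gcongr; exact sum_inv_sqrt_le T

theorem ucb_sub_lcb_le {h : History d} {T : ℕ} (hT : h.length + 1 ≤ T) (i : Fin d) :
    ucb h i - lcb h i ≤ widthBound √(6 * Real.log T) (pulls h i) := by
  unfold ucb lcb widthBound
  split_ifs with hN
  -- Here `(√0)⁻¹ = 0`, so the width 1 comes from the indicator in `widthBound`.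
  · simp [hN]
  · have hk : (0 : ℝ) < pulls h i := by exact_mod_cast Nat.pos_of_ne_zero hN
    have hlog : Real.log (h.length + 1) ≤ Real.log T :=
      Real.log_le_log (by positivity) (by exact_mod_cast hT)
    have hrad : 2 * radius h i ≤ √(6 * Real.log T) * (√(pulls h i))⁻¹ := by
      rw [← Real.sqrt_inv, ← Real.sqrt_mul' _ (by positivity), radius,
        show (2 : ℝ) = √4 by rw [show (4 : ℝ) = 2 ^ 2 by norm_num]; simp,
        ← Real.sqrt_mul (by norm_num)]
      refine Real.sqrt_le_sqrt ?_
      rw [show √(4 : ℝ) = 2 by rw [show (4 : ℝ) = 2 ^ 2 by norm_num]; simp, ← div_eq_mul_inv,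
        ← mul_div_assoc, div_le_div_iff₀ (by positivity) hk]
      nlinarith
    have h1 := min_le_right 1 (empMean h i + radius h i)
    have h2 := le_max_right 0 (empMean h i - radius h i)
    linarith

/-- A pathwise identity: the successive selections of item i find its counter at 0, 1, …, each value
once, so the charges add up to a sum over the final counter's range. -/
theorem sum_expect_widthBound (π : Policy d) (θ : Param d) (w : ℕ → ℝ≥0∞) (i : Fin d) (T : ℕ) :
    ∑ t ∈ Finset.range T, expect (historyLaw π θ t) (fun h =>
        expect (π h) fun x => if x i = true then w (pulls h i) else 0)
      = expect (historyLaw π θ T) fun h => ∑ k ∈ Finset.range (pulls h i), w k := by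
  induction T with
  | zero => simp [expect_historyLaw_zero, pulls]
  | succ T ih =>
    rw [Finset.sum_range_succ, ih, expect_historyLaw_succ, ← expect_add]
    refine expect_congr fun h _ => ?_
    rw [← expect_const (π h) (∑ k ∈ Finset.range (pulls h i), w k), ← expect_add]
    refine expect_congr fun x _ => ?_
    rw [← expect_const (outcomeLaw θ) (_ + _)]
    refine expect_congr fun z _ => ?_
    rw [pulls_cons]
    split_ifs
    · rw [Finset.sum_range_succ]
    · simp

/-! ### The regret of CUCB -/

open Classical in
/-- The regret of an optimistic decision is controlled by the widths of the confidence intervals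
of its items and the number of confidence intervals that miss the parameter. -/
theorem gap_le_of_mem_maximizers {𝒳 : Finset (BVec d)} {f : Reward d}
    (hf : f ∈ lipschitzClass 𝒳) (θ : Param d) {h : History d} {x y : BVec d}
    (hx : x ∈ maximizers 𝒳 (index f h)) (hy : y ∈ 𝒳) :
    f y θ.toReal - f x θ.toReal ≤ ∑ i, (2 * (if Miss θ i h then 1 else 0)
      + if x i = true then ucb h i - lcb h i else 0) := by
  have hθ : θ.toReal ∈ Set.Icc (0 : Fin d → ℝ) 1 := ⟨fun i => (θ i).2.1, fun i => (θ i).2.2⟩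
  -- The projection of θ onto the confidence box: it agrees with θ on every interval that does not
  -- miss and differs by at most 1 elsewhere.
  set u : Fin d → ℝ := fun i => max (lcb h i) (min (ucb h i) (θ.toReal i)) with hu
  have hlu := lcb_le_ucb h
  have huI : u ∈ Set.Icc (lcb h) (ucb h) :=
    ⟨fun i => le_max_left _ _, fun i => max_le (hlu i) (min_le_left _ _)⟩
  have hsub := Icc_lcb_ucb_subset h
  have hdist : ∀ i, |u i - θ.toReal i| ≤ if Miss θ i h then 1 else 0 := by
    intro i
    split_ifs with hm
    · have h1 := (hsub huI).1 i
      have h2 := (hsub huI).2 i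
      have h3 := hθ.1 i
      have h4 := hθ.2 i
      simp only [Pi.zero_apply, Pi.one_apply] at h1 h2 h3 h4
      rw [abs_le]; constructor <;> linarith
    · have hm' := not_not.1 hm
      simp only [hu, Param.toReal, min_eq_right hm'.2, max_eq_right hm'.1, sub_self, abs_zero,
        le_refl]
  have hopt : f y θ.toReal - ∑ i, (if Miss θ i h then 1 else 0) ≤ index f h y := by
    have hle : f y u ≤ index f h y := by
      refine le_csSup ⟨f y u + ∑ i : Fin d, 1, ?_⟩ ⟨u, huI, rfl⟩
      rintro _ ⟨v, hv, rfl⟩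
      have := (abs_le.1 (hf y hy v (hsub hv) u (hsub huI))).2
      have h2 : ∑ i with y i = true, |v i - u i| ≤ ∑ i : Fin d, (1 : ℝ) := by
        refine (Finset.sum_le_sum_of_subset_of_nonneg (Finset.filter_subset _ _)
          fun _ _ _ => abs_nonneg _).trans (Finset.sum_le_sum fun i _ => ?_)
        have h1 := (hsub huI).1 i
        have h2 := (hsub huI).2 i
        have h3 := (hsub hv).1 i
        have h4 := (hsub hv).2 i
        simp only [Pi.zero_apply, Pi.one_apply] at h1 h2 h3 h4
        rw [abs_le]; constructor <;> linarith
      linarith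
    have h1 := (abs_le.1 (hf y hy u (hsub huI) _ hθ)).1
    have h2 : ∑ i with y i = true, |u i - θ.toReal i| ≤ ∑ i, (if Miss θ i h then 1 else 0) :=
      (Finset.sum_le_sum_of_subset_of_nonneg (Finset.filter_subset _ _)
          fun _ _ _ => abs_nonneg _).trans (Finset.sum_le_sum fun i _ => hdist i)
    linarith
  have hpess : index f h x ≤ f x θ.toReal + ∑ i, ((if Miss θ i h then 1 else 0)
      + if x i = true then ucb h i - lcb h i else 0) := by
    refine csSup_le ⟨_, u, huI, rfl⟩ ?_
    rintro _ ⟨v, hv, rfl⟩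
    have h1 := (abs_le.1 (hf x hx.1 v (hsub hv) _ hθ)).2
    have h2 : ∑ i with x i = true, |v i - θ.toReal i| ≤ ∑ i, ((if Miss θ i h then 1 else 0)
        + if x i = true then ucb h i - lcb h i else 0) := by
      rw [Finset.sum_filter]
      refine Finset.sum_le_sum fun i _ => ?_
      have hd := hdist i
      split_ifs at hd ⊢ <;> try simp
      all_goals
        have h1 := huI.1 i
        have h2 := huI.2 i
        have h3 := hv.1 i
        have h4 := hv.2 i
        have h5 := abs_le.1 hd
        rw [abs_le]
        constructor <;> linarith
    linarith
  -- Optimism: θ-reward of y ≲ index of y ≤ index of x ≲ θ-reward of x. Each approximate inequality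
  -- pays for the misses once, hence the factor 2.
  have hmax := hx.2 y hy
  have hsplit : ∑ i, (2 * (if Miss θ i h then (1 : ℝ) else 0)
      + if x i = true then ucb h i - lcb h i else 0)
      = ∑ i, (if Miss θ i h then (1 : ℝ) else 0) + ∑ i, ((if Miss θ i h then 1 else 0)
      + if x i = true then ucb h i - lcb h i else 0) := by
    rw [← Finset.sum_add_distrib]
    exact Finset.sum_congr rfl fun i _ => by ring
  linarith

theorem sum_expect_gap_le {𝒳 : Finset (BVec d)} {f : Reward d} (hf : f ∈ lipschitzClass 𝒳)
    {π : Policy d} (hπ : ∀ h, ∀ x ∈ (π h).support, x ∈ maximizers 𝒳 (index f h))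
    (θ : Param d) {y : BVec d} (hy : y ∈ 𝒳) (T : ℕ) :
    ∑ t ∈ Finset.range T, expect (decisionLaw π θ t)
        (fun x => ENNReal.ofReal (f y θ.toReal - f x θ.toReal))
      ≤ ENNReal.ofReal (d * (5 + √(6 * Real.log T) * (2 * √T))) := by
  classical
  set w : ℕ → ℝ≥0∞ := fun k => ENNReal.ofReal (widthBound √(6 * Real.log T) k) with hw
  have hL : 0 ≤ √(6 * Real.log T) := Real.sqrt_nonneg _
  have hround : ∀ t ∈ Finset.range T, expect (decisionLaw π θ t)
        (fun x => ENNReal.ofReal (f y θ.toReal - f x θ.toReal))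
      ≤ ∑ i, (2 * expect (historyLaw π θ t) (fun h => if Miss θ i h then 1 else 0)
        + expect (historyLaw π θ t) (fun h =>
          expect (π h) fun x => if x i = true then w (pulls h i) else 0)) := by
    intro t ht
    have hswap : ∑ i, (2 * expect (historyLaw π θ t) (fun h => if Miss θ i h then 1 else 0)
        + expect (historyLaw π θ t) (fun h =>
          expect (π h) fun x => if x i = true then w (pulls h i) else 0))
        = expect (historyLaw π θ t) fun h => expect (π h) fun x =>
          ∑ i, (2 * (if Miss θ i h then 1 else 0)
            + if x i = true then w (pulls h i) else 0) := by
      simp only [expect_finsetSum, expect_add, expect_const_mul, expect_const]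
    rw [hswap, expect_decisionLaw]
    refine expect_mono fun h hh => expect_mono fun x hx => ?_
    refine (ENNReal.ofReal_le_ofReal (gap_le_of_mem_maximizers hf θ (hπ h x hx) hy)).trans ?_
    have hlen : h.length + 1 ≤ T := by
      rw [length_of_mem_support hh]; exact Finset.mem_range.1 ht
    have hlu := lcb_le_ucb h
    rw [ENNReal.ofReal_sum_of_nonneg fun i _ => by
      have := hlu i
      split_ifs <;> linarith]
    refine Finset.sum_le_sum fun i _ => ?_
    refine ENNReal.ofReal_add_le.trans (add_le_add ?_ ?_)
    · split_ifs <;> simp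
    · split_ifs
      · exact ENNReal.ofReal_le_ofReal (ucb_sub_lcb_le hlen i)
      · simp
  refine (Finset.sum_le_sum hround).trans ?_
  rw [Finset.sum_comm]
  have hitem : ∀ i ∈ (Finset.univ : Finset (Fin d)), ∑ t ∈ Finset.range T,
      (2 * expect (historyLaw π θ t) (fun h => if Miss θ i h then 1 else 0)
        + expect (historyLaw π θ t) (fun h =>
          expect (π h) fun x => if x i = true then w (pulls h i) else 0))
      ≤ ENNReal.ofReal (5 + √(6 * Real.log T) * (2 * √T)) := by
    intro i _
    rw [Finset.sum_add_distrib, sum_expect_widthBound π θ w, ← Finset.mul_sum]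
    -- The constant 5 is 2 · 2 for the misses, whose probabilities sum to at most 2, plus 1 for the
    -- first selection of the item.
    calc _ ≤ 2 * ENNReal.ofReal 2 + ENNReal.ofReal (1 + √(6 * Real.log T) * (2 * √T)) := by
          gcongr
          · refine (Finset.sum_le_sum fun t _ => expect_miss_le π θ i t).trans ?_
            rw [← ENNReal.ofReal_sum_of_nonneg]
            · exact ENNReal.ofReal_le_ofReal (sum_telescope_le T)
            · intro n _
              have : 1 / ((n : ℝ) + 2) ≤ 1 / (n + 1) :=
                one_div_le_one_div_of_le (by positivity) (by linarith)
              linarith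
          · refine expect_le_const fun h hh => ?_
            rw [← ENNReal.ofReal_sum_of_nonneg fun k _ => widthBound_nonneg hL k]
            refine ENNReal.ofReal_le_ofReal (sum_widthBound_le hL ?_)
            exact (pulls_le_length h i).trans (length_of_mem_support hh).le
      _ = _ := by
          rw [show (2 : ℝ≥0∞) = ENNReal.ofReal 2 by simp, ← ENNReal.ofReal_mul (by norm_num),
            ← ENNReal.ofReal_add (by norm_num) (by positivity)]
          congr 1; ring
  refine (Finset.sum_le_card_nsmul _ _ _ hitem).trans (le_of_eq ?_)
  rw [Finset.card_univ, Fintype.card_fin, nsmul_eq_mul, ENNReal.ofReal_mul (by positivity),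
    ENNReal.ofReal_natCast]

theorem regret_le_of_mem_maximizers {𝒳 : Finset (BVec d)} (h𝒳 : 𝒳.Nonempty) {f : Reward d}
    (hf : f ∈ lipschitzClass 𝒳)
    {π : Policy d} (hπ : ∀ h, ∀ x ∈ (π h).support, x ∈ maximizers 𝒳 (index f h))
    (θ : Param d) (T : ℕ) :
    regret 𝒳 f π θ T ≤ d * (5 + √(6 * Real.log T) * (2 * √T)) := by
  obtain ⟨y, hy, hymax⟩ := 𝒳.exists_max_image (fun x => f x θ.toReal) h𝒳
  rw [← ENNReal.ofReal_le_ofReal_iff (by positivity)]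
  refine le_trans ?_ (sum_expect_gap_le hf hπ θ hy T)
  rw [regret_eq_sum_gap, iSup_eq_of_isGreatest (f := fun x => f x θ.toReal) hy hymax]
  -- The sum runs over all of {0,1}^d, and outside 𝒳 a gap may be negative; passing to positive
  -- parts only increases the sum.
  refine (ENNReal.ofReal_le_ofReal (Finset.sum_le_sum fun t _ => Finset.sum_le_sum fun x _ =>
    mul_le_mul_of_nonneg_left (le_max_left _ 0) ENNReal.toReal_nonneg)).trans (le_of_eq ?_)
  rw [ENNReal.ofReal_sum_of_nonneg fun t _ => Finset.sum_nonneg fun x _ => by positivity]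
  refine Finset.sum_congr rfl fun t _ => ?_
  rw [← expect_ofReal _ fun x => le_max_right _ _]
  simp

theorem minimaxRegret_le_of_isCUCB {𝒳 : Finset (BVec d)} (h𝒳 : 𝒳.Nonempty)
    {𝓕 : Set (Reward d)} (h𝓕 : 𝓕 ⊆ lipschitzClass 𝒳) {alg : Algorithm d}
    (halg : IsCUCB 𝒳 𝓕 alg) {T : ℕ} (hT : 2 ≤ T) :
    minimaxRegret 𝒳 𝓕 alg T ≤ ((10 * d * √(T * Real.log T) : ℝ) : EReal) := by
  refine iSup₂_le fun f hf => iSup_le fun θ => ?_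
  rw [EReal.coe_le_coe_iff]
  refine (regret_le_of_mem_maximizers h𝒳 (h𝓕 hf) (halg f hf) θ T).trans ?_
  have hT' : (2 : ℝ) ≤ T := by exact_mod_cast hT
  have hlog : Real.log 2 ≤ Real.log T := Real.log_le_log (by norm_num) hT'
  have hlog2 := Real.log_two_gt_d9
  set s := √(T * Real.log T) with hs
  -- As 2 log 2 > 1, the additive 5 is absorbed into 5 s; the other term is 2√6 s ≤ 5 s.
  have hs1 : 1 ≤ s := by
    rw [hs, Real.one_le_sqrt]; nlinarith
  have h6 : √6 ≤ 5 / 2 := by rw [Real.sqrt_le_left (by norm_num)]; norm_num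
  have hprod : √(6 * Real.log T) * (2 * √T) = 2 * √6 * s := by
    rw [hs, Real.sqrt_mul (by norm_num), Real.sqrt_mul (by positivity)]; ring
  rw [hprod]
  calc (d : ℝ) * (5 + 2 * √6 * s) ≤ d * (10 * s) := by
        gcongr; nlinarith
    _ = _ := by ring

/-! ### Comparison of the algorithms -/

theorem zero_mem_regularClass (𝒳 : Finset (BVec d)) : (fun _ _ => 0) ∈ regularClass 𝒳 := by
  refine ⟨fun x _ u _ v _ => ?_, fun x _ u _ v _ _ => le_rfl, fun x _ θ => by
    simp [outcomeReward]⟩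
  simpa using Finset.sum_nonneg fun i _ => abs_nonneg (u i - v i)

/-- The zero reward has zero regret under every algorithm. Nonnegativity permits replacing a
possibly negative constant K by `max K 0` in `not_isMinimaxOptimal`. -/
theorem optimalRegret_nonneg {𝒳 : Finset (BVec d)} {𝓕 : Set (Reward d)}
    (h𝓕 : regularClass 𝒳 ⊆ 𝓕) (T : ℕ) : 0 ≤ optimalRegret 𝒳 𝓕 T := by
  refine le_iInf₂ fun alg _ => ?_
  refine le_trans (le_of_eq ?_) (le_minimaxRegret (h𝓕 (zero_mem_regularClass 𝒳)) (fun _ => 0) T)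
  simp [regret]

theorem optimalRegret_le {𝒳 : Finset (BVec d)} (h𝒳 : 𝒳.Nonempty) {𝓕 : Set (Reward d)}
    (h𝓕 : 𝓕 ⊆ lipschitzClass 𝒳) {T : ℕ} (hT : 2 ≤ T) :
    optimalRegret 𝒳 𝓕 T ≤ ((10 * d * √(T * Real.log T) : ℝ) : EReal) := by
  obtain ⟨alg, halg⟩ := exists_isCUCB h𝒳 𝓕
  exact (iInf₂_le alg fun f hf h x hx => (halg f hf h x hx).1).trans
    (minimaxRegret_le_of_isCUCB h𝒳 h𝓕 halg hT)

/-- After squaring and dividing by T this is log T = o(T^(2a - 1)), with 2a - 1 > 0. -/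
theorem isLittleO_sqrt_mul_log_rpow {a : ℝ} (ha : 1 / 2 < a) :
    (fun T : ℕ => √((T : ℝ) * Real.log T)) =o[atTop] fun T : ℕ => (T : ℝ) ^ a := by
  have h := (isLittleO_log_rpow_atTop (show 0 < 2 * a - 1 by linarith)).comp_tendsto
    tendsto_natCast_atTop_atTop (k := ((↑) : ℕ → ℝ))
  rw [Asymptotics.isLittleO_iff] at h ⊢
  intro c hc
  filter_upwards [h (show 0 < c ^ 2 by positivity), eventually_ge_atTop 1] with T hT hT1
  have hT1' : (1 : ℝ) ≤ T := by exact_mod_cast hT1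
  have hpos : (0 : ℝ) < T := by linarith
  simp only [Function.comp_apply, Real.norm_eq_abs] at hT
  rw [abs_of_nonneg (Real.log_nonneg hT1'), abs_of_nonneg (by positivity)] at hT
  rw [Real.norm_of_nonneg (Real.sqrt_nonneg _), Real.norm_of_nonneg (by positivity)]
  rw [Real.sqrt_le_left (by positivity), mul_pow, ← Real.rpow_natCast ((T : ℝ) ^ a),
    ← Real.rpow_mul hpos.le]
  calc (T : ℝ) * Real.log T ≤ T * (c ^ 2 * (T : ℝ) ^ (2 * a - 1)) := by gcongr
    _ = c ^ 2 * (T : ℝ) ^ (a * (2 : ℕ)) := by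
        rw [show a * (2 : ℕ) = 1 + (2 * a - 1) by push_cast; ring, Real.rpow_add hpos,
          Real.rpow_one]
        ring

/-- An algorithm whose minimax regret grows faster than `√(T log T)` is not minimax optimal. -/
theorem not_isMinimaxOptimal {𝒳 : Finset (BVec d)} (h𝒳 : 𝒳.Nonempty) {𝓕 : Set (Reward d)}
    (h𝓕 : regularClass 𝒳 ⊆ 𝓕) (h𝓕' : 𝓕 ⊆ lipschitzClass 𝒳) {alg : Algorithm d} {a : ℝ}
    (ha : 1 / 2 < a)
    (hle : ∀ T : ℕ, 1 ≤ T →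
      ((1 / 4 * (T : ℝ) ^ a : ℝ) : EReal) ≤ minimaxRegret 𝒳 𝓕 alg T) :
    ¬ IsMinimaxOptimal 𝒳 𝓕 alg := by
  rintro ⟨K, hK⟩
  set K' := max K 0
  -- With this constant the upper bound falls below T^a / 8, against the lower bound T^a / 4; the
  -- added 1 keeps the denominator positive when K' d = 0.
  have hc : 0 < 1 / (8 * (K' * (10 * d) + 1)) := by positivity
  obtain ⟨T, hT, ho, hT2⟩ := (hK.and (((Asymptotics.isLittleO_iff.1
    (isLittleO_sqrt_mul_log_rpow ha)) hc).and (eventually_ge_atTop 2))).exists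
  have h1 : ((1 / 4 * (T : ℝ) ^ a : ℝ) : EReal)
      ≤ ((K' * (10 * d * √(T * Real.log T)) : ℝ) : EReal) := by
    refine (hle T (by omega)).trans (hT.trans ?_)
    rw [EReal.coe_mul]
    refine (mul_le_mul_of_nonneg_right (EReal.coe_le_coe_iff.2 (le_max_left K 0))
      (optimalRegret_nonneg h𝓕 T)).trans ?_
    exact mul_le_mul_of_nonneg_left (optimalRegret_le h𝒳 h𝓕' hT2)
      (EReal.coe_nonneg.2 (le_max_right K 0))
  rw [EReal.coe_le_coe_iff] at h1
  rw [Real.norm_of_nonneg (Real.sqrt_nonneg _), Real.norm_of_nonneg (by positivity)] at ho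
  have hpos : 0 < (T : ℝ) ^ a := Real.rpow_pos_of_pos (by exact_mod_cast (by omega : 0 < T)) _
  have hK' : 0 ≤ K' * (10 * d) := by positivity
  have h2 : K' * (10 * d * √(T * Real.log T)) ≤ 1 / 8 * (T : ℝ) ^ a := by
    calc _ = K' * (10 * d) * √(T * Real.log T) := by ring
      _ ≤ (K' * (10 * d) + 1) * (1 / (8 * (K' * (10 * d) + 1)) * (T : ℝ) ^ a) := by
          gcongr; linarith
      _ = _ := by
          generalize K' * (10 * d) = q at hK'
          field_simp
  linarith

theorem half_lt_one_sub_one_div {n : ℕ} (hn : 3 ≤ n) : (1 / 2 : ℝ) < 1 - 1 / n := by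
  have : (1 : ℝ) / n ≤ 1 / 3 := one_div_le_one_div_of_le (by norm_num) (by exact_mod_cast hn)
  linarith

theorem thompsonSampling_allOrNothing_ge (hd : 1 ≤ d) {𝓕 : Set (Reward d)}
    (h𝓕 : regularClass (allOrNothing d) ⊆ 𝓕) {TS : Algorithm d}
    (hTS : IsThompsonSampling (allOrNothing d) 𝓕 TS) {T : ℕ} (hT : 1 ≤ T) :
    ((1 / 4 * (T : ℝ) ^ (1 - 1 / (d : ℝ)) : ℝ) : EReal)
      ≤ minimaxRegret (allOrNothing d) 𝓕 TS T := by
  have : NeZero d := ⟨by omega⟩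
  have h := thompsonSampling_minimaxRegret_ge (S := Finset.univ) Finset.univ_nonempty
    (by simp [allOrNothing]) (by simp [allOrNothing]) ⟨fun _ => true, by simp [allOrNothing]⟩
    h𝓕 hTS hT
  rwa [Finset.card_univ, Fintype.card_fin] at h

theorem thompsonSampling_blockOrLast_ge {m : ℕ} (hm : 1 ≤ m) {𝓕 : Set (Reward (m + 1))}
    (h𝓕 : regularClass (blockOrLast m) ⊆ 𝓕) {TS : Algorithm (m + 1)}
    (hTS : IsThompsonSampling (blockOrLast m) 𝓕 TS) {T : ℕ} (hT : 1 ≤ T) :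
    ((1 / 4 * (T : ℝ) ^ (1 - 1 / (m : ℝ)) : ℝ) : EReal)
      ≤ minimaxRegret (blockOrLast m) 𝓕 TS T := by
  have hcard : (Finset.univ.erase (Fin.last m)).card = m := by simp
  have hne : (Finset.univ.erase (Fin.last m)).Nonempty := by
    rw [← Finset.card_pos, hcard]; omega
  have h := thompsonSampling_minimaxRegret_ge hne
    (by simp only [blockOrLast, Finset.mem_insert, Finset.mem_singleton, forall_eq_or_imp,
          forall_eq, Finset.mem_erase, decide_eq_true_eq]
        exact ⟨fun _ i hi => hi.1, fun ⟨i, hi, hi'⟩ => absurd hi' hi.1⟩)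
    (by simp [blockOrLast]) ⟨fun i => decide (i ≠ Fin.last m), by simp [blockOrLast], by
      obtain ⟨i, hi⟩ := hne
      exact ⟨i, hi, by simpa using hi⟩⟩ h𝓕 hTS hT
  rwa [hcard] at h

end SemiBandit

open SemiBandit in
theorem mainTheorem8 :
    ∃ C₁ C₁' : ℝ, 0 < C₁ ∧ 0 < C₁' ∧
      -- Thompson Sampling on `{(1,…,1), (0,…,0)}`
      (∀ d : ℕ, 1 ≤ d → ∀ 𝓕 : Set (Reward d),
        regularClass (allOrNothing d) ⊆ 𝓕 → 𝓕 ⊆ lipschitzClass (allOrNothing d) →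
        ∀ TS : Algorithm d, IsThompsonSampling (allOrNothing d) 𝓕 TS →
          (∀ T : ℕ, 1 ≤ T →
            ((C₁ * (T : ℝ) ^ (1 - 1 / (d : ℝ)) : ℝ) : EReal)
              ≤ minimaxRegret (allOrNothing d) 𝓕 TS T) ∧
          (3 ≤ d → ¬ IsMinimaxOptimal (allOrNothing d) 𝓕 TS)) ∧
      -- Thompson Sampling on `{e_1 + … + e_m, e_{m+1}}`
      (∀ m : ℕ, 1 ≤ m → ∀ 𝓕 : Set (Reward (m + 1)),
        regularClass (blockOrLast m) ⊆ 𝓕 → 𝓕 ⊆ lipschitzClass (blockOrLast m) →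
        ∀ TS : Algorithm (m + 1), IsThompsonSampling (blockOrLast m) 𝓕 TS →
          (∀ T : ℕ, 1 ≤ T →
            ((C₁ * (T : ℝ) ^ (1 - 1 / (m : ℝ)) : ℝ) : EReal)
              ≤ minimaxRegret (blockOrLast m) 𝓕 TS T) ∧
          (3 ≤ m → ¬ IsMinimaxOptimal (blockOrLast m) 𝓕 TS)) ∧
      -- CUCB on an arbitrary set of decisions
      (∀ (d : ℕ) (𝒳 : Finset (BVec d)), 1 ≤ d → 𝒳.Nonempty →
        ∀ 𝓕 : Set (Reward d), 𝓕 ⊆ lipschitzClass 𝒳 →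
        ∀ CUCB : Algorithm d, IsCUCB 𝒳 𝓕 CUCB → ∀ T : ℕ, 2 ≤ T →
          minimaxRegret 𝒳 𝓕 CUCB T ≤ ((C₁' * d * √(T * Real.log T) : ℝ) : EReal)) := by
  refine ⟨1 / 4, 10, by norm_num, by norm_num, fun d hd 𝓕 h𝓕 h𝓕' TS hTS => ?_,
    fun m hm 𝓕 h𝓕 h𝓕' TS hTS => ?_, fun d 𝒳 _ h𝒳 𝓕 h𝓕 alg halg T hT =>
      minimaxRegret_le_of_isCUCB h𝒳 h𝓕 halg hT⟩
  · have hle : ∀ T : ℕ, 1 ≤ T → _ := fun T hT => thompsonSampling_allOrNothing_ge hd h𝓕 hTS hT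
    exact ⟨hle, fun h3 => not_isMinimaxOptimal ⟨fun _ => true, by simp [allOrNothing]⟩ h𝓕 h𝓕'
      (half_lt_one_sub_one_div h3) hle⟩
  · have hle : ∀ T : ℕ, 1 ≤ T → _ := fun T hT => thompsonSampling_blockOrLast_ge hm h𝓕 hTS hT
    exact ⟨hle, fun h3 => not_isMinimaxOptimal
      ⟨fun i => decide (i = Fin.last m), by simp [blockOrLast]⟩ h𝓕 h𝓕'
      (half_lt_one_sub_one_div h3) hle⟩
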